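/- **Theorem.** Let $d\ge 1$, let $x\in\mathbb R^{n_0}$ be nonzero, let $n_1,\dots,n_{d-1}\ge 1$ and $p:=n_d\ge 3$, and let $\sigma_1,\dots,\sigma_d>0$ be fixed. Let $W_\ell\in\mathbb R^{n_\ell\times n_{\ell-1}}$ ($1\le\ell\le d$) be independent random matrices with i.i.d. $N(0,\sigma_\ell^2)$ entries, and put $h_1=W_1x$ and $h_\ell=W_\ell\,\mathrm{ReLU}(h_{\ell-1})$ for $2\le\ell\le d$. Let $\pi$ be the continuous part of the law of $h_d$, i.e. that law restricted to $\mathbb R^p\setminus\{0\}$ (its normalisation plays no role). Consider the model $Y\mid\theta\sim N_p(\theta,I_p)$, $\theta\in\mathbb R^p$, under the loss $\|\theta-\delta\|^2$, with risk $R(\theta,\delta)=\mathbb E_\theta\|\theta-\delta(Y)\|^2$, and let $$\delta_{\mathrm{BNN,fixed}}(y)=\frac{\int\theta\,e^{-\|y-\theta\|^2/2}\,\pi(d\theta)}{\int e^{-\|y-\theta\|^2/2}\,\pi(d\theta)}$$ be the posterior mean, i.e. the Bayes rule for $\pi$. Let $V=2^{d-1}\|x\|^2\prod_{\ell=1}^d\sigma_\ell^2\prod_{\ell=1}^{d-1}T_\ell$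 where, given $(k_1,\dots,k_{d-1})$, the $T_\ell\sim\Gamma(k_\ell/2,1)$ are independent, and $(k_1,\dots,k_{d-1})\in\prod_{\ell=1}^{d-1}\{1,\dots,n_\ell\}$ has probability proportional to $\prod_{\ell=1}^{d-1}\binom{n_\ell}{k_\ell}$. For $u\ge 0$ let $$\psi(u)=\mathbb E\Big[\tfrac1{1+V}\,\Big|\,\|Y\|^2=u\Big]=\frac{\mathbb E\big[(1+V)^{-p/2-1}e^{-u/(2(1+V))}\big]}{\mathbb E\big[(1+V)^{-p/2}e^{-u/(2(1+V))}\big]},$$ where $Y\mid V=v\sim N_p(0,(1+v)I_p)$. Then: 1. $\delta_{\mathrm{BNN,fixed}}$ is measurable and $\delta_{\mathrm{BNN,fixed}}(y)=(1-\psi(\|y\|^2))\,y$ for every $y\in\mathbb R^p$; 2. there are $c>0$ and $u_0$ such that $u\,\psi(u)\ge c\,u^{1/d}$ for all $u\ge u_0$; in particular $u\,\psi(u)\to\infty$ as $u\to\infty$; 3. there is $r$ such that $R(\theta,\delta_{\mathrm{BNN,fixed}})>p$ for all $\theta$ with $\|\theta\|\ge r$; 4. $\delta_{\mathrm{BNN,fixed}}$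 is not minimax: $\sup_\theta R(\theta,\delta_{\mathrm{BNN,fixed}})\ne\inf_\delta\sup_\theta R(\theta,\delta)$, the infimum being over all measurable $\delta:\mathbb R^p\to\mathbb R^p$. -/

import Mathlib

open MeasureTheory ProbabilityTheory Filter Topology
open scoped ENNReal NNReal

namespace BNN

noncomputable section

/-! ### The network and the prior it induces -/

/-- Componentwise ReLU. -/
def relu {k : ℕ} (h : Fin k → ℝ) : Fin k → ℝ := fun i => max (h i) 0

/-- What is fed from layer `ℓ` into layer `ℓ + 1`: the raw input when `ℓ = 0`,
the ReLU of the hidden layer when `ℓ ≥ 1`. -/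
def feed {k : ℕ} : ℕ → (Fin k → ℝ) → (Fin k → ℝ)
  | 0, h => h
  | _ + 1, h => relu h

/-- Law of an `a × b` weight matrix with i.i.d. `N(0, s²)` entries. -/
def weightLaw (a b : ℕ) (s : ℝ) : Measure (Fin a → Fin b → ℝ) :=
  Measure.pi fun _ => Measure.pi fun _ => gaussianReal 0 (s ^ 2).toNNReal

/-- Law of the layer `h_ℓ`, where `h_0 = x` and `h_{ℓ+1} = W_{ℓ+1} (feed ℓ h_ℓ)`, the weight matrix
`W_{ℓ+1}` (with `n (ℓ+1)` rows, `n ℓ` columns and entries `N(0, σ (ℓ+1) ^ 2)`)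
being independent of `h_ℓ`. -/
def layerLaw (n : ℕ → ℕ) (σ : ℕ → ℝ) (x : EuclideanSpace ℝ (Fin (n 0))) :
    (ℓ : ℕ) → Measure (Fin (n ℓ) → ℝ)
  | 0 => Measure.dirac (WithLp.ofLp x)
  | ℓ + 1 =>
    ((layerLaw n σ x ℓ).prod (weightLaw (n (ℓ + 1)) (n ℓ) (σ (ℓ + 1)))).map
      fun q => Matrix.mulVec (Matrix.of q.2) (feed ℓ q.1)

/-- The fixed-scale BNN prior for `θ = h_d ∈ ℝ^{n d}`: the continuous part of the law of the output
of the depth `d` network, that is, the law with its atom at the origin removed.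
(It is not normalised; the Bayes rule below does not depend on the normalisation.) -/
def prior (n : ℕ → ℕ) (σ : ℕ → ℝ) (d : ℕ) (x : EuclideanSpace ℝ (Fin (n 0))) :
    Measure (EuclideanSpace ℝ (Fin (n d))) :=
  ((layerLaw n σ x d).map (WithLp.toLp 2)).restrict {0}ᶜ

/-! ### Bayes rule, risk and minimaxity in the model `Y | θ ∼ N_p(θ, I_p)` -/

/-- Value of the density of `N_p(0, s I_p)` at the points of squared norm `r`. -/
def gaussDensity (p : ℕ) (s r : ℝ) : ℝ :=
  (2 * Real.pi * s) ^ (-(p : ℝ) / 2) * Real.exp (-r / (2 * s))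

/-- The Bayes rule under quadratic loss for the prior `ν`: the posterior mean
`E[θ | Y = y]`, the posterior being proportional to `φ_p(y - θ) ν(dθ)`. -/
def bayesRule {p : ℕ} (ν : Measure (EuclideanSpace ℝ (Fin p))) (y : EuclideanSpace ℝ (Fin p)) :
    EuclideanSpace ℝ (Fin p) :=
  (∫ θ, gaussDensity p 1 (‖y - θ‖ ^ 2) ∂ν)⁻¹ • ∫ θ, gaussDensity p 1 (‖y - θ‖ ^ 2) • θ ∂ν

/-- Quadratic risk `R(θ, δ) = E_θ ‖θ - δ(Y)‖²`, where `Y ∼ N_p(θ, I_p)`. -/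
def risk {p : ℕ} (θ : EuclideanSpace ℝ (Fin p))
    (δ : EuclideanSpace ℝ (Fin p) → EuclideanSpace ℝ (Fin p)) : ℝ≥0∞ :=
  ∫⁻ y, ENNReal.ofReal (‖θ - δ y‖ ^ 2) ∂(multivariateGaussian θ 1)

/-- `δ` is minimax: its maximal risk is the infimum, over all estimators, of the maximal risk. -/
def IsMinimax {p : ℕ} (δ : EuclideanSpace ℝ (Fin p) → EuclideanSpace ℝ (Fin p)) : Prop :=
  (⨆ θ, risk θ δ) =
    ⨅ (η : EuclideanSpace ℝ (Fin p) → EuclideanSpace ℝ (Fin p)) (_ : Measurable η), ⨆ θ, risk θ η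

/-- The Bayes rule induced by the fixed-scale BNN. -/
def bnnRule (n : ℕ → ℕ) (σ : ℕ → ℝ) (d : ℕ) (x : EuclideanSpace ℝ (Fin (n 0))) :
    EuclideanSpace ℝ (Fin (n d)) → EuclideanSpace ℝ (Fin (n d)) :=
  bayesRule (prior n σ d x)

/-! ### The effective output variance and the shrinkage function -/

/-- Mixture over `1 ≤ k ≤ m` of the laws `Γ(k/2, 1)` with weights `2^{-m} (m choose k)`. -/
def gammaMixture (m : ℕ) : Measure ℝ :=
  ∑ k ∈ Finset.Icc 1 m, ((m.choose k : ℝ≥0∞) / 2 ^ m) • gammaMeasure ((k : ℝ) / 2) 1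

/-- Law (not normalised) of the effective output variance
`V = 2^{d-1} ‖x‖² (∏_{ℓ=1}^d σ_ℓ²) (∏_{ℓ=1}^{d-1} T_ℓ)`. The `T_ℓ` are independent with law
`gammaMixture (n ℓ)`: equivalently, the multi-index `(k_1, …, k_{d-1})` has weight
`2^{-(n_1 + ⋯ + n_{d-1})} ∏ (n_ℓ choose k_ℓ)`, and given it the `T_ℓ` are
independent with laws `Γ(k_ℓ/2, 1)`. The index `i : Fin (d - 1)` stands for `ℓ = i + 1`. -/
def varianceLaw (n : ℕ → ℕ) (σ : ℕ → ℝ) (d : ℕ) (x : EuclideanSpace ℝ (Fin (n 0))) : Measure ℝ :=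
  (Measure.pi fun i : Fin (d - 1) => gammaMixture (n ((i : ℕ) + 1))).map fun t =>
    2 ^ (d - 1) * ‖x‖ ^ 2 * (∏ ℓ ∈ Finset.Icc 1 d, σ ℓ ^ 2) * ∏ i, t i

/-- `ψ(u) = E[1 / (1 + V) | ‖Y‖² = u]`, where `Y | V = v ∼ N_p(0, (1 + v) I_p)` and `p = n d`:
by Bayes' theorem, `V` given `‖Y‖² = u` has law proportional to
`(1 + v)^{-p/2} exp (- u / (2 (1 + v)))` times the law of `V`. -/
def psi (n : ℕ → ℕ) (σ : ℕ → ℝ) (d : ℕ) (x : EuclideanSpace ℝ (Fin (n 0))) (u : ℝ) : ℝ :=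
  (∫ v, 1 / (1 + v) * gaussDensity (n d) (1 + v) u ∂(varianceLaw n σ d x)) /
    ∫ v, gaussDensity (n d) (1 + v) u ∂(varianceLaw n σ d x)

end

end BNN

/-! Conditionally on a hidden layer `h`, the next one is a centred Gaussian vector with variance `σ
^ 2 * ‖relu h‖ ^ 2` per coordinate. ReLU is positively homogeneous, and half the squared norm of a
rectified standard Gaussian vector is an atom at 0 plus a mixture of `Γ(k/2, 1)` laws
(`map_sum_sq_relu`). By induction on depth the output is therefore `√V • g` with `g` standard
Gaussian, up to an atom at 0, which the prior discards (`prior_eq_map`). Given `V = v` the posterior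
mean is `v / (1 + v) • y`; averaging over the posterior of `V` gives the factor `1 - ψ`
(`bayesRule_map_prod_stdGaussian`).

Growth of `ψ`: the product of `d - 1` Gamma variables is of order `a ^ (d - 1)` with probability
exponentially small in `a`. At `u = a ^ d` and `v` of order `a ^ (d - 1)` the likelihood exponent `u
/ (2 (1 + v))` is also of order `a`. The two costs balance, so at least half of the posterior mass
of `V` lies below a multiple of `u ^ (1 - 1/d)`, and `u ψ(u)` is at least of order `u ^ (1/d)`
(`exists_le_mul_integral_div_integral`).

Risk: Stein's identity writes the risk minus `p` as the mean of `u ψ ^ 2 - 4 u ψ' - 2 p ψ` at `u =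
‖Y‖ ^ 2` (`risk_radial_shrinkage`). As `ψ' ≤ 0`, this is at least `ψ (u ψ - 2 p)`: positive for
large `u`, and never below `-2 p`. When `θ` is far away, the ball where it may be negative has
exponentially less weight than a unit ball on the way to `θ`, so the risk exceeds `p`
(`exists_forall_lt_risk_radial_shrinkage`). The estimator `y` has constant risk `p`, which rules out
minimaxity. -/

namespace BNN

/-! ### Laws of squared norms of rectified Gaussian vectors -/

/-- Two finite measures on `ℝ` are equal if their moment generating functions are finite and agree
on a convex open neighbourhood of `0`. -/
theorem ext_of_mgf_eqOn {μ ν : Measure ℝ} [IsFiniteMeasure μ] [IsFiniteMeasure ν] {U : Set ℝ}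
    (hU : IsOpen U) (hc : Convex ℝ U) (h0 : (0 : ℝ) ∈ U)
    (hμ : ∀ t ∈ U, Integrable (fun x => Real.exp (t * x)) μ)
    (hν : ∀ t ∈ U, Integrable (fun x => Real.exp (t * x)) ν)
    (h : ∀ t ∈ U, ∫ x, Real.exp (t * x) ∂μ = ∫ x, Real.exp (t * x) ∂ν) : μ = ν := by
  have hsub : ∀ ρ : Measure ℝ, (∀ t ∈ U, Integrable (fun x => Real.exp (t * x)) ρ) →
      U ⊆ interior (integrableExpSet id ρ) := fun ρ hρ =>
    hU.subset_interior_iff.2 fun t ht => hρ t ht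
  have hAn : ∀ ρ : Measure ℝ, (∀ t ∈ U, Integrable (fun x => Real.exp (t * x)) ρ) →
      AnalyticOnNhd ℂ (complexMGF id ρ) (Complex.re ⁻¹' U) := fun ρ hρ z hz =>
    analyticOnNhd_complexMGF z (hsub ρ hρ hz)
  -- The complex moment generating functions are analytic on the vertical strip over `U` and agree
  -- at real points near 0, hence on the whole strip. Its imaginary axis carries the characteristic
  -- functions.
  have hEq : Set.EqOn (complexMGF id μ) (complexMGF id ν) (Complex.re ⁻¹' U) := by
    refine AnalyticOnNhd.eqOn_of_preconnected_of_frequently_eq (hAn μ hμ) (hAn ν hν)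
      (hc.linear_preimage Complex.reLm).isPreconnected (z₀ := ((0 : ℝ) : ℂ)) (by simpa using h0) ?_
    have hreal : ∃ᶠ x : ℝ in 𝓝[≠] 0, complexMGF id μ x = complexMGF id ν x := by
      refine Eventually.frequently ?_
      filter_upwards [mem_nhdsWithin_of_mem_nhds (hU.mem_nhds h0)] with y hy
      rw [complexMGF_ofReal, complexMGF_ofReal]
      simpa [mgf] using h y hy
    have hcont : Tendsto (fun x : ℝ => (x : ℂ)) (𝓝[≠] 0) (𝓝[≠] ((0 : ℝ) : ℂ)) :=
      Complex.continuous_ofReal.continuousAt.continuousWithinAt.tendsto_nhdsWithin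
        (by intro x hx; simpa using hx)
    exact hcont.frequently hreal
  apply Measure.ext_of_charFun
  ext t
  have := hEq (x := (t : ℂ) * Complex.I) (by simpa using h0)
  simpa [complexMGF, charFun_apply_real, mul_assoc, mul_comm, mul_left_comm] using this

theorem gammaMeasure_eq_withDensity (a : ℝ) :
    gammaMeasure a 1 = (volume.restrict (Set.Ioi 0)).withDensity
      fun x => ENNReal.ofReal (1 / Real.Gamma a * x ^ (a - 1) * Real.exp (-x)) := by
  rw [gammaMeasure, restrict_Ioi_eq_restrict_Ici, ← withDensity_indicator measurableSet_Ici]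
  congr 1
  ext x
  by_cases hx : 0 ≤ x
  · rw [Set.indicator_of_mem (by simpa using hx), gammaPDF_of_nonneg hx]
    simp
  · rw [Set.indicator_of_notMem (by simpa using hx), gammaPDF_of_neg (not_le.1 hx)]

theorem integral_gammaMeasure {a : ℝ} (ha : 0 < a) (f : ℝ → ℝ) :
    ∫ x, f x ∂(gammaMeasure a 1) =
      ∫ x in Set.Ioi 0, (1 / Real.Gamma a * x ^ (a - 1) * Real.exp (-x)) * f x := by
  rw [gammaMeasure_eq_withDensity, integral_withDensity_eq_integral_toReal_smul (by fun_prop)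
    (by simp)]
  refine setIntegral_congr_fun measurableSet_Ioi fun x hx => ?_
  have : 0 < Real.Gamma a := Real.Gamma_pos_of_pos ha
  have hx' : 0 < x := hx
  simp only [smul_eq_mul]
  rw [ENNReal.toReal_ofReal (by positivity)]

theorem integral_exp_gammaMeasure {a t : ℝ} (ha : 0 < a) (ht : t < 1) :
    ∫ x, Real.exp (t * x) ∂(gammaMeasure a 1) = (1 - t) ^ (-a) := by
  have hG : 0 < Real.Gamma a := Real.Gamma_pos_of_pos ha
  have ht' : 0 < 1 - t := by linarith
  rw [integral_gammaMeasure ha]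
  have : ∀ x : ℝ, (1 / Real.Gamma a * x ^ (a - 1) * Real.exp (-x)) * Real.exp (t * x) =
      1 / Real.Gamma a * (x ^ (a - 1) * Real.exp (-((1 - t) * x))) := fun x => by
    rw [mul_assoc, mul_assoc, ← Real.exp_add]
    ring_nf
  simp_rw [this]
  rw [integral_const_mul, Real.integral_rpow_mul_exp_neg_mul_Ioi ha ht', one_div (1 - t),
    Real.inv_rpow ht'.le, ← Real.rpow_neg ht'.le]
  field_simp

/-- A non-integrable function has Bochner integral 0, so a nonzero value of the integral proves
integrability. The same device serves again below. -/
theorem integrable_exp_gammaMeasure {a t : ℝ} (ha : 0 < a) (ht : t < 1) :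
    Integrable (fun x => Real.exp (t * x)) (gammaMeasure a 1) := by
  refine not_imp_comm.1 integral_undef ?_
  rw [integral_exp_gammaMeasure ha ht]
  exact (Real.rpow_pos_of_pos (by linarith) _).ne'

theorem ae_pos_gammaMeasure (a : ℝ) : ∀ᵐ x ∂(gammaMeasure a 1), 0 < x := by
  rw [gammaMeasure_eq_withDensity]
  exact (withDensity_absolutelyContinuous _ _).ae_le (ae_restrict_mem measurableSet_Ioi)

theorem isProbabilityMeasure_gammaMeasure_half {k m : ℕ} (hk : k ∈ Finset.Icc 1 m) :
    IsProbabilityMeasure (gammaMeasure ((k : ℝ) / 2) 1) :=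
  isProbabilityMeasure_gammaMeasure
    (div_pos (Nat.cast_pos.2 (Finset.mem_Icc.1 hk).1) two_pos) one_pos

theorem choose_div_two_pow_ne_top (m k : ℕ) : (m.choose k : ℝ≥0∞) / 2 ^ m ≠ ∞ :=
  ENNReal.div_ne_top (ENNReal.natCast_ne_top _) (by simp)

instance (m : ℕ) : IsFiniteMeasure (gammaMixture m) where
  measure_univ_lt_top := by
    rw [gammaMixture, Measure.finsetSum_apply]
    refine ENNReal.sum_lt_top.2 fun k hk => ?_
    have := isProbabilityMeasure_gammaMeasure_half hk
    simpa using (choose_div_two_pow_ne_top m k).lt_top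

theorem ae_pos_gammaMixture (m : ℕ) : ∀ᵐ x ∂(gammaMixture m), 0 < x := by
  rw [gammaMixture, ae_iff, Measure.finsetSum_apply]
  refine Finset.sum_eq_zero fun k _ => ?_
  have := ae_iff.1 (ae_pos_gammaMeasure ((k : ℝ) / 2))
  rw [Measure.smul_apply, this, smul_zero]

theorem integrable_exp_gammaMixture (m : ℕ) {t : ℝ} (ht : t < 1) :
    Integrable (fun x => Real.exp (t * x)) (gammaMixture m) := by
  rw [gammaMixture, integrable_finsetSum_measure]
  intro k hk
  exact (integrable_exp_gammaMeasure (div_pos (Nat.cast_pos.2 (Finset.mem_Icc.1 hk).1) two_pos)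
    ht).smul_measure (choose_div_two_pow_ne_top m k)

theorem integral_exp_gammaMixture (m : ℕ) {t : ℝ} (ht : t < 1) :
    ∫ x, Real.exp (t * x) ∂(gammaMixture m) =
      ∑ k ∈ Finset.Icc 1 m, (m.choose k : ℝ) / 2 ^ m * (1 - t) ^ (-((k : ℝ) / 2)) := by
  have hint := integrable_exp_gammaMixture m ht
  rw [gammaMixture, integrable_finsetSum_measure] at hint
  rw [gammaMixture, integral_finsetSum_measure hint]
  refine Finset.sum_congr rfl fun k hk => ?_
  rw [integral_smul_measure, integral_exp_gammaMeasure
    (div_pos (Nat.cast_pos.2 (Finset.mem_Icc.1 hk).1) two_pos) ht]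
  simp [ENNReal.toReal_div]

/-- With probability one half the coordinate is rectified to 0, contributing 1; otherwise half its
square is `Γ(1/2, 1)`. -/
theorem integral_exp_sq_pos_part {t : ℝ} (ht : t < 1) :
    ∫ g, Real.exp (t * (max g 0 ^ 2 / 2)) ∂(gaussianReal 0 1) =
      (1 + (1 - t) ^ (-(1 / 2 : ℝ))) / 2 := by
  have ht' : 0 < 1 - t := by linarith
  have hint : ∀ b : ℝ, 0 < b → IntegrableOn (fun g : ℝ => Real.exp (-b * g ^ 2)) Set.univ :=
    fun b hb => by simpa using integrable_exp_neg_mul_sq hb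
  have hneg : ∫ g in Set.Iic (0 : ℝ), Real.exp (-(1 / 2) * g ^ 2) =
      ∫ g in Set.Ioi (0 : ℝ), Real.exp (-(1 / 2) * g ^ 2) := by
    rw [← neg_zero, ← integral_comp_neg_Ioi]
    simp
  have e1 : ∀ g ∈ Set.Iic (0 : ℝ), Real.exp (-(1 / 2) * g ^ 2) * Real.exp (t * (max g 0 ^ 2 / 2)) =
      Real.exp (-(1 / 2) * g ^ 2) := fun g hg => by simp [max_eq_right hg.out]
  have e2 : ∀ g ∈ Set.Ioi (0 : ℝ), Real.exp (-(1 / 2) * g ^ 2) * Real.exp (t * (max g 0 ^ 2 / 2)) =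
      Real.exp (-((1 - t) / 2) * g ^ 2) := fun g hg => by
    rw [max_eq_left hg.out.le, ← Real.exp_add]; ring_nf
  rw [integral_gaussianReal_eq_integral_smul one_ne_zero]
  have e0 : ∀ g : ℝ, gaussianPDFReal 0 1 g • Real.exp (t * (max g 0 ^ 2 / 2)) =
      (√(2 * Real.pi))⁻¹ * (Real.exp (-(1 / 2) * g ^ 2) * Real.exp (t * (max g 0 ^ 2 / 2))) := by
    intro g
    rw [gaussianPDFReal, smul_eq_mul, mul_assoc]
    congr 3
    · simp
    · simp; ring
  simp_rw [e0]
  rw [integral_const_mul, ← setIntegral_univ, ← Set.Iic_union_Ioi (a := (0 : ℝ)),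
    setIntegral_union (Set.Iic_disjoint_Ioi le_rfl) measurableSet_Ioi,
    setIntegral_congr_fun measurableSet_Iic e1, setIntegral_congr_fun measurableSet_Ioi e2, hneg,
    integral_gaussian_Ioi, integral_gaussian_Ioi]
  · rw [Real.rpow_neg ht'.le, ← Real.sqrt_eq_rpow]
    have h1 : √(Real.pi / (1 / 2)) = √(2 * Real.pi) := by congr 1; ring
    have h2 : √(Real.pi / ((1 - t) / 2)) = √(2 * Real.pi) / √(1 - t) := by
      rw [← Real.sqrt_div (by positivity)]; congr 1; field_simp
    rw [h1, h2]
    have : √(2 * Real.pi) ≠ 0 := by positivity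
    field_simp
  · exact ((hint _ (by norm_num)).mono_set (Set.subset_univ _)).congr_fun
      (fun g hg => (e1 g hg).symm) measurableSet_Iic
  · exact ((hint _ (by linarith)).mono_set (Set.subset_univ _)).congr_fun
      (fun g hg => (e2 g hg).symm) measurableSet_Ioi

/-- Half the squared norm of a rectified standard Gaussian vector is a mixture of Gamma laws. -/
theorem map_sum_sq_relu (m : ℕ) :
    (Measure.pi fun _ : Fin m => gaussianReal 0 1).map (fun g => ∑ i, relu g i ^ 2 / 2) =
      ((2 : ℝ≥0∞) ^ m)⁻¹ • Measure.dirac 0 + gammaMixture m := by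
  have hmeas : Measurable fun g : Fin m → ℝ => ∑ i, relu g i ^ 2 / 2 := by
    unfold relu; fun_prop
  have hfin : IsFiniteMeasure (((2 : ℝ≥0∞) ^ m)⁻¹ • Measure.dirac (0 : ℝ)) :=
    Measure.smul_finite _ (by simp)
  have hleft : ∀ t : ℝ, t < 1 → ∫ x, Real.exp (t * x) ∂((Measure.pi fun _ : Fin m =>
      gaussianReal 0 1).map (fun g => ∑ i, relu g i ^ 2 / 2)) =
      ((1 + (1 - t) ^ (-(1 / 2 : ℝ))) / 2) ^ m := fun t ht => by
    rw [integral_map hmeas.aemeasurable (by fun_prop)]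
    simp_rw [Finset.mul_sum, Real.exp_sum, relu]
    rw [integral_fintype_prod_eq_prod (𝕜 := ℝ)
      (fun (_ : Fin m) g => Real.exp (t * (max g 0 ^ 2 / 2)))]
    simp [integral_exp_sq_pos_part ht, div_pow]
  have hdirac : ∀ t : ℝ, Integrable (fun x => Real.exp (t * x))
      (((2 : ℝ≥0∞) ^ m)⁻¹ • Measure.dirac (0 : ℝ)) := fun t =>
    (integrable_dirac (by simp)).smul_measure (by simp)
  refine ext_of_mgf_eqOn isOpen_Iio (convex_Iio 1) (by simp) (fun t ht => ?_) (fun t ht => ?_)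
    fun t ht => ?_
  · refine not_imp_comm.1 integral_undef ?_
    rw [hleft t ht]
    have : 0 < (1 - t) ^ (-(1 / 2 : ℝ)) := Real.rpow_pos_of_pos (by linarith [ht.out]) _
    positivity
  · exact (hdirac t).add_measure (integrable_exp_gammaMixture m ht)
  -- The binomial theorem applied to `((1 + s) / 2) ^ m` with `s = (1 - t) ^ (-1/2)`: the term `k =
  -- 0` is the atom, and `s ^ k` is the transform of `Γ(k/2, 1)`.
  · rw [hleft t ht, integral_add_measure (hdirac t) (integrable_exp_gammaMixture m ht),
      integral_smul_measure, integral_dirac, integral_exp_gammaMixture m ht, div_pow, add_comm 1,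
      add_pow, Finset.sum_range_succ', add_div, Finset.sum_div, add_comm,
      Finset.range_eq_Ico, Finset.sum_Ico_add' (fun k => ((1 - t) ^ (-(1 / 2 : ℝ))) ^ k *
        1 ^ (m - k) * (m.choose k : ℝ) / 2 ^ m) 0 m 1]
    congr 1
    · simp
    · refine Finset.sum_congr (by ext; simp) fun k _ => ?_
      rw [← Real.rpow_mul_natCast (by linarith [ht.out])]
      have : -(1 / 2 : ℝ) * k = -((k : ℝ) / 2) := by ring
      rw [this]; ring

/-! ### The law of the network output -/

theorem map_sum_mul_gaussianReal {b : ℕ} (v : ℝ≥0) (z : Fin b → ℝ) :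
    (Measure.pi fun _ : Fin b => gaussianReal 0 v).map (fun w => ∑ j, w j * z j) =
      gaussianReal 0 (v * (∑ j, z j ^ 2).toNNReal) := by
  apply Measure.ext_of_charFun
  ext t
  have hm : Measurable fun w : Fin b → ℝ => ∑ j, w j * z j := by fun_prop
  rw [charFun_apply_real, integral_map hm.aemeasurable (by fun_prop)]
  have : ∀ w : Fin b → ℝ, Complex.exp (t * ((∑ j, w j * z j : ℝ) : ℂ) * Complex.I) =
      ∏ j, Complex.exp (((t * z j : ℝ) : ℂ) * w j * Complex.I) := fun w => by
    rw [← Complex.exp_sum]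
    push_cast
    rw [Finset.mul_sum, Finset.sum_mul]
    congr 1
    exact Finset.sum_congr rfl fun j _ => by ring
  simp_rw [this]
  rw [integral_fintype_prod_eq_prod (𝕜 := ℂ)
    (fun j (w : ℝ) => Complex.exp (((t * z j : ℝ) : ℂ) * w * Complex.I))]
  simp_rw [← charFun_apply_real, charFun_gaussianReal, ← Complex.exp_sum]
  congr 1
  have h0 : 0 ≤ ∑ j, z j ^ 2 := Finset.sum_nonneg fun j _ => sq_nonneg _
  push_cast
  rw [Real.coe_toNNReal _ h0]
  push_cast
  simp only [mul_zero, zero_mul, zero_sub]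
  rw [Finset.sum_neg_distrib, ← Finset.sum_div, Finset.mul_sum, Finset.sum_mul]
  congr 2
  exact Finset.sum_congr rfl fun j _ => by ring

/-- The rows of the weight matrix are independent, and each one paired with `z` is Gaussian with
variance `s ^ 2 * ‖z‖ ^ 2`. Thus a layer depends on its input only through the norm. -/
theorem map_mulVec_weightLaw (a b : ℕ) (s : ℝ) (z : Fin b → ℝ) :
    (weightLaw a b s).map (fun W => Matrix.mulVec (Matrix.of W) z) =
      (Measure.pi fun _ : Fin a => gaussianReal 0 1).map
        (fun g => √(s ^ 2 * ∑ j, z j ^ 2) • g) := by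
  have h0 : 0 ≤ ∑ j, z j ^ 2 := Finset.sum_nonneg fun j _ => sq_nonneg _
  have e1 : (fun W : Fin a → Fin b → ℝ => Matrix.mulVec (Matrix.of W) z) =
      fun W i => (fun w : Fin b → ℝ => ∑ j, w j * z j) (W i) := rfl
  have e2 : (fun g : Fin a → ℝ => √(s ^ 2 * ∑ j, z j ^ 2) • g) =
      fun g i => (fun y : ℝ => √(s ^ 2 * ∑ j, z j ^ 2) * y) (g i) := rfl
  have hm : Measurable fun w : Fin b → ℝ => ∑ j, w j * z j := by fun_prop
  rw [e1, e2, weightLaw, Measure.pi_map_pi (μ := fun _ : Fin a => Measure.pi fun _ : Fin b =>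
      gaussianReal 0 (s ^ 2).toNNReal) (f := fun _ w => ∑ j, w j * z j) (fun _ => hm.aemeasurable),
    Measure.pi_map_pi (f := fun _ y => √(s ^ 2 * ∑ j, z j ^ 2) * y) (fun _ => by fun_prop)]
  congr 1
  ext1 i
  rw [map_sum_mul_gaussianReal, gaussianReal_map_const_mul, mul_zero]
  congr 1
  ext
  simp [sq_nonneg, h0, mul_pow, Real.sq_sqrt]

instance (a b : ℕ) (s : ℝ) : IsProbabilityMeasure (weightLaw a b s) := by
  unfold weightLaw; infer_instance

theorem measurable_feed {k : ℕ} (ℓ : ℕ) : Measurable (feed (k := k) ℓ) := by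
  cases ℓ with
  | zero => exact measurable_id
  | succ ℓ =>
    change Measurable (relu (k := k))
    unfold relu; fun_prop

theorem measurable_mulVec_feed {a b : ℕ} (ℓ : ℕ) :
    Measurable fun q : (Fin b → ℝ) × (Fin a → Fin b → ℝ) =>
      Matrix.mulVec (Matrix.of q.2) (feed ℓ q.1) := by
  have := measurable_feed (k := b) ℓ
  refine measurable_pi_lambda _ fun i => ?_
  simp only [Matrix.mulVec, dotProduct, Matrix.of_apply]
  fun_prop

instance (n : ℕ → ℕ) (σ : ℕ → ℝ) (x : EuclideanSpace ℝ (Fin (n 0))) (ℓ : ℕ) :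
    IsProbabilityMeasure (layerLaw n σ x ℓ) := by
  induction ℓ with
  | zero => unfold layerLaw; infer_instance
  | succ ℓ ih =>
    unfold layerLaw
    exact Measure.isProbabilityMeasure_map (measurable_mulVec_feed ℓ).aemeasurable

theorem lintegral_layerLaw_succ (n : ℕ → ℕ) (σ : ℕ → ℝ) (x : EuclideanSpace ℝ (Fin (n 0)))
    (ℓ : ℕ) {f : (Fin (n (ℓ + 1)) → ℝ) → ℝ≥0∞} (hf : Measurable f) :
    ∫⁻ h, f h ∂(layerLaw n σ x (ℓ + 1)) =
      ∫⁻ h, ∫⁻ g, f (√(σ (ℓ + 1) ^ 2 * ∑ j, feed ℓ h j ^ 2) • g)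
        ∂(Measure.pi fun _ => gaussianReal 0 1) ∂(layerLaw n σ x ℓ) := by
  have hm := measurable_mulVec_feed (a := n (ℓ + 1)) (b := n ℓ) ℓ
  rw [layerLaw, lintegral_map hf hm]
  refine (lintegral_prod _ (hf.comp hm).aemeasurable).trans ?_
  refine lintegral_congr fun h => ?_
  rw [← lintegral_map (f := f) (g := fun g : Fin (n (ℓ + 1)) → ℝ =>
      √(σ (ℓ + 1) ^ 2 * ∑ j, feed ℓ h j ^ 2) • g) hf (by fun_prop), ← map_mulVec_weightLaw,
    lintegral_map hf]
  · rfl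
  · exact hm.comp (measurable_prodMk_left (x := h))

/-- Multiplier relating the effective variance to the product of the Gamma variables. -/
noncomputable def varianceScale (n : ℕ → ℕ) (σ : ℕ → ℝ) (d : ℕ)
    (x : EuclideanSpace ℝ (Fin (n 0))) : ℝ :=
  2 ^ (d - 1) * ‖x‖ ^ 2 * ∏ ℓ ∈ Finset.Icc 1 d, σ ℓ ^ 2

theorem varianceScale_nonneg (n : ℕ → ℕ) (σ : ℕ → ℝ) (d : ℕ)
    (x : EuclideanSpace ℝ (Fin (n 0))) : 0 ≤ varianceScale n σ d x :=
  mul_nonneg (by positivity) (Finset.prod_nonneg fun _ _ => sq_nonneg _)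

theorem varianceScale_pos {n : ℕ → ℕ} {σ : ℕ → ℝ} {d : ℕ}
    {x : EuclideanSpace ℝ (Fin (n 0))} (hσ : ∀ ℓ, 1 ≤ ℓ → ℓ ≤ d → 0 < σ ℓ) (hx : x ≠ 0) :
    0 < varianceScale n σ d x :=
  mul_pos (by positivity) (Finset.prod_pos fun ℓ hℓ =>
    pow_pos (hσ ℓ (Finset.mem_Icc.1 hℓ).1 (Finset.mem_Icc.1 hℓ).2) 2)

theorem varianceLaw_eq_map (n : ℕ → ℕ) (σ : ℕ → ℝ) (d : ℕ) (x : EuclideanSpace ℝ (Fin (n 0))) :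
    varianceLaw n σ d x = (Measure.pi fun i : Fin (d - 1) => gammaMixture (n ((i : ℕ) + 1))).map
      fun t => varianceScale n σ d x * ∏ i, t i := rfl

instance (n : ℕ → ℕ) (σ : ℕ → ℝ) (d : ℕ) (x : EuclideanSpace ℝ (Fin (n 0))) :
    IsFiniteMeasure (varianceLaw n σ d x) := by
  rw [varianceLaw_eq_map]; infer_instance

theorem ae_pos_pi_gammaMixture {k : ℕ} (m : Fin k → ℕ) :
    ∀ᵐ t ∂(Measure.pi fun i => gammaMixture (m i)), ∀ i, 0 < t i :=
  eventually_all.2 fun i =>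
    (Measure.tendsto_eval_ae_ae (i := i)).eventually (ae_pos_gammaMixture (m i))

theorem ae_nonneg_varianceLaw (n : ℕ → ℕ) (σ : ℕ → ℝ) (d : ℕ)
    (x : EuclideanSpace ℝ (Fin (n 0))) : ∀ᵐ v ∂(varianceLaw n σ d x), 0 ≤ v := by
  rw [varianceLaw_eq_map, ae_map_iff (by fun_prop) measurableSet_Ici]
  filter_upwards [ae_pos_pi_gammaMixture fun i : Fin (d - 1) => n ((i : ℕ) + 1)] with t ht
  exact mul_nonneg (varianceScale_nonneg n σ d x) (Finset.prod_nonneg fun i _ => (ht i).le)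

theorem ae_pos_varianceLaw {n : ℕ → ℕ} {σ : ℕ → ℝ} {d : ℕ}
    {x : EuclideanSpace ℝ (Fin (n 0))} (hσ : ∀ ℓ, 1 ≤ ℓ → ℓ ≤ d → 0 < σ ℓ) (hx : x ≠ 0) :
    ∀ᵐ v ∂(varianceLaw n σ d x), 0 < v := by
  rw [varianceLaw_eq_map, ae_map_iff (by fun_prop) measurableSet_Ioi]
  filter_upwards [ae_pos_pi_gammaMixture fun i : Fin (d - 1) => n ((i : ℕ) + 1)] with t ht
  exact mul_pos (varianceScale_pos hσ hx) (Finset.prod_pos fun i _ => ht i)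

/-- Peels off the Gamma factor of the last hidden layer. Depth `e + 2` is the first at which there
is one. -/
theorem lintegral_varianceLaw_succ (n : ℕ → ℕ) (σ : ℕ → ℝ) (e : ℕ)
    (x : EuclideanSpace ℝ (Fin (n 0))) {F : ℝ → ℝ≥0∞} (hF : Measurable F) :
    ∫⁻ v, F v ∂(varianceLaw n σ (e + 2) x) =
      ∫⁻ v, ∫⁻ q, F (σ (e + 2) ^ 2 * (2 * v * q)) ∂(gammaMixture (n (e + 1)))
        ∂(varianceLaw n σ (e + 1) x) := by
  have hmp := measurePreserving_piFinSuccAbove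
    (fun i : Fin (e + 1) => gammaMixture (n ((i : ℕ) + 1))) (Fin.last e)
  have hscale : varianceScale n σ (e + 2) x =
      2 * σ (e + 2) ^ 2 * varianceScale n σ (e + 1) x := by
    simp only [varianceScale, Nat.add_sub_cancel, Nat.add_succ_sub_one]
    rw [Finset.prod_Icc_succ_top (by omega), pow_succ]
    ring
  have e1 : ∀ t : Fin (e + 1) → ℝ, F (varianceScale n σ (e + 2) x * ∏ i, t i) =
      (fun z : ℝ × (Fin e → ℝ) => F (σ (e + 2) ^ 2 *
        (2 * (varianceScale n σ (e + 1) x * ∏ i, z.2 i) * z.1)))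
          (MeasurableEquiv.piFinSuccAbove (fun _ => ℝ) (Fin.last e) t) := fun t => by
    simp only [MeasurableEquiv.piFinSuccAbove_apply]
    rw [Fin.prod_univ_castSucc, hscale]
    simp only [Fin.insertNthEquiv, Equiv.coe_fn_symm_mk, Fin.removeNth, Fin.succAbove_last]
    ring_nf
  rw [varianceLaw_eq_map, varianceLaw_eq_map, lintegral_map hF (by fun_prop),
    lintegral_map ?_ (by fun_prop)]
  · change ∫⁻ t : Fin (e + 1) → ℝ, F (varianceScale n σ (e + 2) x * ∏ i, t i)
      ∂(Measure.pi fun i : Fin (e + 1) => gammaMixture (n ((i : ℕ) + 1))) = _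
    simp_rw [e1]
    rw [hmp.lintegral_comp (f := fun z : ℝ × (Fin e → ℝ) => F (σ (e + 2) ^ 2 *
        (2 * (varianceScale n σ (e + 1) x * ∏ i, z.2 i) * z.1))) (by fun_prop),
      lintegral_prod_symm _ (by fun_prop)]
    simp [Fin.succAbove_last]
  · exact Measurable.lintegral_prod_right' (f := fun z : ℝ × ℝ =>
      F (σ (e + 2) ^ 2 * (2 * z.1 * z.2))) (by fun_prop)

/-- The condition `f 0 = 0` hides the atom: a hidden layer rectified to 0 makes all later layers 0.
The binomial weights of `gammaMixture` are left unnormalised, which makes the equality exact. -/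
theorem lintegral_layerLaw_of_zero (n : ℕ → ℕ) (σ : ℕ → ℝ) (x : EuclideanSpace ℝ (Fin (n 0)))
    (e : ℕ) {f : (Fin (n (e + 1)) → ℝ) → ℝ≥0∞} (hf : Measurable f) (hf0 : f 0 = 0) :
    ∫⁻ h, f h ∂(layerLaw n σ x (e + 1)) =
      ∫⁻ v, ∫⁻ g, f (√v • g) ∂(Measure.pi fun _ => gaussianReal 0 1)
        ∂(varianceLaw n σ (e + 1) x) := by
  induction e with
  | zero =>
    have hG : Measurable fun v : ℝ => ∫⁻ g, f (√v • g) ∂(Measure.pi fun _ => gaussianReal 0 1) :=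
      Measurable.lintegral_prod_right' (f := fun z : ℝ × (Fin (n (0 + 1)) → ℝ) =>
        f (√z.1 • z.2)) (by fun_prop)
    rw [lintegral_layerLaw_succ n σ x 0 hf, layerLaw, lintegral_dirac, varianceLaw_eq_map,
      lintegral_map hG (by fun_prop)]
    -- Without hidden layers the product of Gamma variables is empty and the variance is a constant.
    have e1 : ∀ t : Fin (0 + 1 - 1) → ℝ, varianceScale n σ (0 + 1) x * ∏ i, t i =
        σ (0 + 1) ^ 2 * ∑ j, feed 0 x.ofLp j ^ 2 := fun t => by
      have : ∏ i, t i = 1 := Finset.prod_of_isEmpty (ι := Fin 0) _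
      rw [this]
      simp [varianceScale, feed, EuclideanSpace.real_norm_sq_eq, mul_comm]
    simp_rw [e1]
    rw [lintegral_const, Measure.pi_univ]
    have : ∏ i : Fin (0 + 1 - 1), gammaMixture (n ((i : ℕ) + 1)) Set.univ = 1 :=
      Finset.prod_of_isEmpty (ι := Fin 0) _
    rw [this, mul_one]
  | succ e ih =>
    have hG : Measurable fun v : ℝ => ∫⁻ g, f (√v • g) ∂(Measure.pi fun _ => gaussianReal 0 1) :=
      Measurable.lintegral_prod_right' (f := fun z : ℝ × (Fin (n (e + 1 + 1)) → ℝ) =>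
        f (√z.1 • z.2)) (by fun_prop)
    have hr := measurable_feed (k := n (e + 1)) (e + 1)
    -- The induction hypothesis is applied to the inner integral as a function of the hidden layer;
    -- it again vanishes at 0.
    rw [lintegral_layerLaw_succ n σ x (e + 1) hf, ih
      (f := fun h => ∫⁻ g, f (√(σ (e + 1 + 1) ^ 2 * ∑ j, feed (e + 1) h j ^ 2) • g)
        ∂(Measure.pi fun _ => gaussianReal 0 1)) (hG.comp (by fun_prop))
        (by simp [feed, relu, hf0]),
      lintegral_varianceLaw_succ n σ e x hG]
    refine lintegral_congr_ae ?_
    filter_upwards [ae_nonneg_varianceLaw n σ (e + 1) x] with v hv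
    have e1 : ∀ g : Fin (n (e + 1)) → ℝ, ∑ j, feed (e + 1) (√v • g) j ^ 2 =
        2 * v * ∑ j, relu g j ^ 2 / 2 := fun g => by
      rw [Finset.mul_sum]
      refine Finset.sum_congr rfl fun j _ => ?_
      have : max (√v * g j) 0 = √v * max (g j) 0 := by
        rw [mul_max_of_nonneg _ _ (Real.sqrt_nonneg v), mul_zero]
      simp only [feed, relu, Pi.smul_apply, smul_eq_mul, this, mul_pow, Real.sq_sqrt hv]
      ring
    have hH : Measurable fun q : ℝ => ∫⁻ g, f (√(σ (e + 1 + 1) ^ 2 * (2 * v * q)) • g)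
        ∂(Measure.pi fun _ => gaussianReal 0 1) := hG.comp (by fun_prop)
    simp_rw [e1]
    rw [← lintegral_map (μ := Measure.pi fun _ : Fin (n (e + 1)) => gaussianReal 0 1)
      (g := fun g => ∑ j, relu g j ^ 2 / 2) hH (by unfold relu; fun_prop), map_sum_sq_relu,
      lintegral_add_measure, lintegral_smul_measure, lintegral_dirac]
    simp [hf0]

/-- The prior is a Gaussian scale mixture, the mixing law being that of the effective variance. -/
theorem prior_eq_map (n : ℕ → ℕ) (σ : ℕ → ℝ) (e : ℕ) (x : EuclideanSpace ℝ (Fin (n 0)))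
    (hσ : ∀ ℓ, 1 ≤ ℓ → ℓ ≤ e + 1 → 0 < σ ℓ) (hx : x ≠ 0) (hp : 1 ≤ n (e + 1)) :
    prior n σ (e + 1) x = ((varianceLaw n σ (e + 1) x).prod
      (stdGaussian (EuclideanSpace ℝ (Fin (n (e + 1)))))).map fun z => √z.1 • z.2 := by
  set p := n (e + 1) with hpdef
  -- Since `p ≥ 1` and `V > 0`, the vector `√V • g` is almost surely nonzero, so restricting to the
  -- complement of 0 removes nothing from the scale mixture.
  have hnull : ∀ᵐ g ∂(Measure.pi fun _ : Fin p => gaussianReal 0 1), g ≠ 0 := by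
    have := nullSingletonClass_gaussianReal (μ := 0) (v := 1) one_ne_zero
    have h := (Measure.tendsto_eval_ae_ae (μ := fun _ : Fin p => gaussianReal 0 1)
      (i := (⟨0, hp⟩ : Fin p))).eventually
      (compl_mem_ae_iff.2 (measure_singleton (μ := gaussianReal 0 1) (0 : ℝ)))
    filter_upwards [h] with g hg h0
    exact hg (by simp [h0])
  ext s hs
  have hs0 : MeasurableSet (s ∩ {0}ᶜ) := hs.inter (measurableSet_singleton _).compl
  have hmeas : Measurable (WithLp.toLp 2 : (Fin p → ℝ) → EuclideanSpace ℝ (Fin p)) := by fun_prop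
  have hA : MeasurableSet ((WithLp.toLp 2 : (Fin p → ℝ) → EuclideanSpace ℝ (Fin p)) ⁻¹'
      (s ∩ {0}ᶜ)) := hmeas hs0
  rw [prior, Measure.restrict_apply hs, Measure.map_apply hmeas hs0, ← lintegral_indicator_one hA,
    lintegral_layerLaw_of_zero n σ x e (measurable_one.indicator hA) (by simp),
    ← lintegral_indicator_one hs, lintegral_map (measurable_one.indicator hs) (by fun_prop)]
  have hind : Measurable (s.indicator (1 : EuclideanSpace ℝ (Fin p) → ℝ≥0∞)) :=
    measurable_one.indicator hs
  refine Eq.trans ?_ (lintegral_prod _ (hind.comp (f := fun z : ℝ × EuclideanSpace ℝ (Fin p) =>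
    √z.1 • z.2) (by fun_prop)).aemeasurable).symm
  refine lintegral_congr_ae ?_
  filter_upwards [ae_pos_varianceLaw hσ hx] with v hv
  rw [← map_pi_eq_stdGaussian, lintegral_map _ hmeas]
  · refine lintegral_congr_ae ?_
    filter_upwards [hnull] with g hg
    have hv' : √v ≠ 0 := (Real.sqrt_pos.2 hv).ne'
    have hg' : g ≠ 0 := hg
    have hne : √v • (WithLp.toLp 2 g : EuclideanSpace ℝ (Fin p)) ≠ 0 := by
      simp [hv', hg']
    have hiff : √v • g ∈ (WithLp.toLp 2 : (Fin p → ℝ) → EuclideanSpace ℝ (Fin p)) ⁻¹' (s ∩ {0}ᶜ) ↔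
        √v • (WithLp.toLp 2 g : EuclideanSpace ℝ (Fin p)) ∈ s :=
      ⟨fun h => h.1, fun h => ⟨h, hne⟩⟩
    by_cases hmem : √v • (WithLp.toLp 2 g : EuclideanSpace ℝ (Fin p)) ∈ s
    · refine (Set.indicator_of_mem (hiff.2 hmem) _).trans ?_
      exact (Set.indicator_of_mem hmem (1 : EuclideanSpace ℝ (Fin p) → ℝ≥0∞)).symm
    · refine (Set.indicator_of_notMem (fun h => hmem (hiff.1 h)) _).trans ?_
      exact (Set.indicator_of_notMem hmem (1 : EuclideanSpace ℝ (Fin p) → ℝ≥0∞)).symm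
  · exact (measurable_one.indicator hs).comp (by fun_prop)

/-! ### Gaussian densities on Euclidean space -/

section GaussianDensity

variable {p : ℕ}

local notation "E" => EuclideanSpace ℝ (Fin p)

theorem gaussDensity_pos {s : ℝ} (hs : 0 < s) (r : ℝ) : 0 < gaussDensity p s r :=
  mul_pos (Real.rpow_pos_of_pos (by positivity) _) (Real.exp_pos _)

@[fun_prop]
theorem continuous_gaussDensity (s : ℝ) : Continuous (gaussDensity p s) := by
  unfold gaussDensity; fun_prop

/-- Half of the Gaussian exponent is spent on absorbing the quadratic growth; the other half remains
as an integrable bound. -/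
theorem one_add_sq_norm_mul_exp_le {b : ℝ} (hb : 0 < b) (y θ : E) :
    (1 + ‖y‖ ^ 2) * Real.exp (-(b * ‖y - θ‖ ^ 2)) ≤
      (1 + 2 * ‖θ‖ ^ 2 + 4 / b) * Real.exp (-(b / 2) * ‖y - θ‖ ^ 2) := by
  have h1 : ‖y‖ ^ 2 ≤ 2 * ‖y - θ‖ ^ 2 + 2 * ‖θ‖ ^ 2 := by
    have : ‖y‖ ≤ ‖y - θ‖ + ‖θ‖ := by simpa using norm_add_le (y - θ) θ
    nlinarith [norm_nonneg y, sq_nonneg (‖y - θ‖ - ‖θ‖)]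
  set t := ‖y - θ‖ ^ 2 with ht
  have ht0 : 0 ≤ t := sq_nonneg _
  have h2 : 1 ≤ Real.exp (b / 2 * t) := Real.one_le_exp (by positivity)
  have h3 : b / 2 * t ≤ Real.exp (b / 2 * t) := by
    linarith [Real.add_one_le_exp (b / 2 * t)]
  have h4 : 2 * t = 4 / b * (b / 2 * t) := by field_simp; ring
  have h5 : 1 + ‖y‖ ^ 2 ≤ (1 + 2 * ‖θ‖ ^ 2 + 4 / b) * Real.exp (b / 2 * t) := by
    have : 4 / b * (b / 2 * t) ≤ 4 / b * Real.exp (b / 2 * t) :=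
      mul_le_mul_of_nonneg_left h3 (by positivity)
    have h6 : (1 + 2 * ‖θ‖ ^ 2) * 1 ≤ (1 + 2 * ‖θ‖ ^ 2) * Real.exp (b / 2 * t) :=
      mul_le_mul_of_nonneg_left h2 (by positivity)
    linarith
  calc (1 + ‖y‖ ^ 2) * Real.exp (-(b * t))
      ≤ (1 + 2 * ‖θ‖ ^ 2 + 4 / b) * Real.exp (b / 2 * t) * Real.exp (-(b * t)) :=
        mul_le_mul_of_nonneg_right h5 (Real.exp_pos _).le
    _ = _ := by
        rw [mul_assoc, ← Real.exp_add]
        ring_nf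

theorem integrable_exp_neg_mul_sq_norm_sub {b : ℝ} (hb : 0 < b) (θ : E) :
    Integrable fun y : E => Real.exp (-b * ‖y - θ‖ ^ 2) := by
  have : Integrable fun y : E => Real.exp (-b * ‖y‖ ^ 2) := by
    refine not_imp_comm.1 integral_undef ?_
    rw [GaussianFourier.integral_rexp_neg_mul_sq_norm hb]
    positivity
  exact this.comp_sub_right θ

/-- Functions of at most quadratic growth are integrable against a Gaussian density. -/
theorem integrable_gaussDensity_smul {F : Type*} [NormedAddCommGroup F] [NormedSpace ℝ F]
    {s : ℝ} (hs : 0 < s) (θ : E) {f : E → F} (hf : AEStronglyMeasurable f volume) {C : ℝ}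
    (hC : ∀ y, ‖f y‖ ≤ C * (1 + ‖y‖ ^ 2)) :
    Integrable fun y => gaussDensity p s (‖y - θ‖ ^ 2) • f y := by
  have hb : 0 < 1 / (2 * s) := by positivity
  have hg : Continuous fun y : E => gaussDensity p s (‖y - θ‖ ^ 2) := by fun_prop
  refine ((integrable_exp_neg_mul_sq_norm_sub (half_pos hb) θ).const_mul
    ((2 * Real.pi * s) ^ (-(p : ℝ) / 2) * (C * (1 + 2 * ‖θ‖ ^ 2 + 4 / (1 / (2 * s)))))).mono'
    (hg.aestronglyMeasurable.smul hf) (Eventually.of_forall fun y => ?_)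
  have hC0 : 0 ≤ C := by
    have := (norm_nonneg _).trans (hC 0)
    simpa using this
  have hk : 0 < (2 * Real.pi * s) ^ (-(p : ℝ) / 2) := Real.rpow_pos_of_pos (by positivity) _
  rw [norm_smul, Real.norm_of_nonneg (gaussDensity_pos hs _).le, gaussDensity,
    mul_assoc (_ ^ _), mul_assoc (_ ^ _)]
  refine mul_le_mul_of_nonneg_left ?_ hk.le
  have e : -‖y - θ‖ ^ 2 / (2 * s) = -(1 / (2 * s) * ‖y - θ‖ ^ 2) := by ring
  rw [e]
  calc Real.exp (-(1 / (2 * s) * ‖y - θ‖ ^ 2)) * ‖f y‖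
      ≤ Real.exp (-(1 / (2 * s) * ‖y - θ‖ ^ 2)) * (C * (1 + ‖y‖ ^ 2)) :=
        mul_le_mul_of_nonneg_left (hC y) (Real.exp_pos _).le
    _ = C * ((1 + ‖y‖ ^ 2) * Real.exp (-(1 / (2 * s) * ‖y - θ‖ ^ 2))) := by ring
    _ ≤ _ := by
        rw [mul_assoc]
        exact mul_le_mul_of_nonneg_left (one_add_sq_norm_mul_exp_le hb y θ) hC0

theorem integrable_gaussDensity {s : ℝ} (hs : 0 < s) (θ : E) :
    Integrable fun y => gaussDensity p s (‖y - θ‖ ^ 2) := by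
  simpa using integrable_gaussDensity_smul (p := p) hs θ (f := fun _ => (1 : ℝ)) (C := 1)
    aestronglyMeasurable_const fun y => by simp

theorem integral_gaussDensity {s : ℝ} (hs : 0 < s) (θ : E) :
    ∫ y, gaussDensity p s (‖y - θ‖ ^ 2) = 1 := by
  rw [integral_sub_right_eq_self (fun y : E => gaussDensity p s (‖y‖ ^ 2)) θ]
  unfold gaussDensity
  have e : ∀ y : E, -‖y‖ ^ 2 / (2 * s) = -(1 / (2 * s)) * ‖y‖ ^ 2 := fun y => by ring
  simp_rw [e]
  rw [integral_const_mul, GaussianFourier.integral_rexp_neg_mul_sq_norm (by positivity),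
    finrank_euclideanSpace, Fintype.card_fin]
  have : Real.pi / (1 / (2 * s)) = 2 * Real.pi * s := by field_simp
  rw [this, ← Real.rpow_add (by positivity)]
  ring_nf
  simp

theorem integral_gaussDensity_smul_id {s : ℝ} (hs : 0 < s) (θ : E) :
    ∫ y, gaussDensity p s (‖y - θ‖ ^ 2) • y = θ := by
  have hodd : ∫ y : E, gaussDensity p s (‖y‖ ^ 2) • y = 0 := by
    have h := integral_neg_eq_self (fun y : E => gaussDensity p s (‖y‖ ^ 2) • y) volume
    simp only [norm_neg, smul_neg] at h
    rw [integral_neg] at h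
    have h2 : (2 : ℝ) • ∫ y : E, gaussDensity p s (‖y‖ ^ 2) • y = 0 := by
      rw [two_smul]
      nth_rewrite 1 [← h]
      exact neg_add_cancel _
    exact (smul_eq_zero.1 h2).resolve_left two_ne_zero
  have hi : Integrable fun y : E => gaussDensity p s (‖y‖ ^ 2) • y := by
    have := integrable_gaussDensity_smul (p := p) hs 0 (f := fun y : E => y) (C := 1)
      aestronglyMeasurable_id fun y => by nlinarith [sq_nonneg (‖y‖ - 1), norm_nonneg y]
    simpa using this
  have h0 := integrable_gaussDensity (p := p) hs 0
  simp only [sub_zero] at h0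
  have h1 := integral_gaussDensity (p := p) hs 0
  simp only [sub_zero] at h1
  rw [← integral_add_right_eq_self (fun y : E => gaussDensity p s (‖y - θ‖ ^ 2) • y) θ]
  simp only [add_sub_cancel_right, smul_add]
  rw [integral_add hi (h0.smul_const θ), hodd, integral_smul_const, h1, zero_add, one_smul]

/-- Proved by comparing characteristic functions. The density makes completing the square and
integration by parts available. -/
theorem stdGaussian_eq_withDensity :
    stdGaussian E = volume.withDensity fun y => ENNReal.ofReal (gaussDensity p 1 (‖y‖ ^ 2)) := by
  have hint := integrable_gaussDensity (p := p) one_pos 0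
  simp only [sub_zero] at hint
  have : IsFiniteMeasure ((volume : Measure E).withDensity fun y =>
      ENNReal.ofReal (gaussDensity p 1 (‖y‖ ^ 2))) :=
    isFiniteMeasure_withDensity_ofReal hint.2
  apply Measure.ext_of_charFun
  ext t
  rw [charFun_stdGaussian, charFun_apply, integral_withDensity_eq_integral_toReal_smul
    (by fun_prop) (by simp)]
  have e : ∀ y : E, (ENNReal.ofReal (gaussDensity p 1 (‖y‖ ^ 2))).toReal •
      Complex.exp ((inner ℝ y t : ℝ) * Complex.I) =
      ((2 * Real.pi) ^ (-(p : ℝ) / 2) : ℝ) *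
        Complex.exp (-((1 / 2 : ℝ) : ℂ) * (‖y‖ : ℂ) ^ 2 + Complex.I * (inner ℝ t y : ℝ)) := by
    intro y
    rw [ENNReal.toReal_ofReal (gaussDensity_pos one_pos _).le, gaussDensity, Complex.exp_add,
      real_inner_comm, Complex.real_smul]
    push_cast
    rw [mul_assoc, mul_comm Complex.I]
    congr 2
    · simp
    · congr 1
      ring
  simp_rw [e]
  rw [integral_const_mul, GaussianFourier.integral_cexp_neg_mul_sq_norm_add (by norm_num),
    finrank_euclideanSpace, Fintype.card_fin, ← mul_assoc]
  have h1 : ((Real.pi : ℂ) / ((1 / 2 : ℝ) : ℂ)) = ((2 * Real.pi : ℝ) : ℂ) := by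
    push_cast; ring
  have h2 : ((p : ℂ) / 2) = ((p / 2 : ℝ) : ℂ) := by push_cast; ring
  rw [h1, h2, ← Complex.ofReal_cpow (by positivity), ← Complex.ofReal_mul,
    ← Real.rpow_add (by positivity)]
  have h3 : -(p : ℝ) / 2 + p / 2 = 0 := by ring
  rw [h3, Real.rpow_zero, Complex.ofReal_one, one_mul, Complex.I_sq]
  push_cast
  ring_nf

theorem integral_stdGaussian {F : Type*} [NormedAddCommGroup F] [NormedSpace ℝ F] (f : E → F) :
    ∫ g, f g ∂(stdGaussian E) = ∫ g, gaussDensity p 1 (‖g‖ ^ 2) • f g := by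
  rw [stdGaussian_eq_withDensity, integral_withDensity_eq_integral_toReal_smul (by fun_prop)
    (by simp)]
  refine integral_congr_ae (Eventually.of_forall fun y => ?_)
  simp only
  rw [ENNReal.toReal_ofReal (gaussDensity_pos one_pos _).le]

/-- Completing the square in the product of prior and sampling densities. -/
theorem gaussDensity_mul_gaussDensity {v : ℝ} (hv : 0 ≤ v) (y g : E) :
    gaussDensity p 1 (‖g‖ ^ 2) * gaussDensity p 1 (‖y - √v • g‖ ^ 2) =
      gaussDensity p (1 + v) (‖y‖ ^ 2) *
        gaussDensity p (1 / (1 + v)) (‖g - (√v / (1 + v)) • y‖ ^ 2) := by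
  have hv1 : 0 < 1 + v := by linarith
  have hsq : √v ^ 2 = v := Real.sq_sqrt hv
  unfold gaussDensity
  rw [mul_mul_mul_comm, mul_mul_mul_comm ((2 * Real.pi * (1 + v)) ^ (-(p : ℝ) / 2)),
    ← Real.mul_rpow (by positivity) (by positivity), ← Real.mul_rpow (by positivity)
    (by positivity), ← Real.exp_add, ← Real.exp_add]
  congr 2
  · field_simp
  · rw [norm_sub_sq_real, norm_sub_sq_real, norm_smul, norm_smul, inner_smul_right,
      inner_smul_right, real_inner_comm, mul_pow, mul_pow, Real.norm_eq_abs, Real.norm_eq_abs,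
      sq_abs, sq_abs, div_pow, hsq]
    field_simp
    ring

theorem integral_gaussDensity_stdGaussian {v : ℝ} (hv : 0 ≤ v) (y : E) :
    ∫ g, gaussDensity p 1 (‖y - √v • g‖ ^ 2) ∂(stdGaussian E) =
      gaussDensity p (1 + v) (‖y‖ ^ 2) := by
  rw [integral_stdGaussian]
  simp_rw [smul_eq_mul, gaussDensity_mul_gaussDensity hv]
  rw [integral_const_mul, integral_gaussDensity (by positivity), mul_one]

/-- By completing the square, `g` given `y` is Gaussian with mean `(√v / (1 + v)) • y`; multiplying
by `√v` gives the linear Bayes rule for a fixed scale. -/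
theorem integral_gaussDensity_smul_stdGaussian {v : ℝ} (hv : 0 ≤ v) (y : E) :
    ∫ g, gaussDensity p 1 (‖y - √v • g‖ ^ 2) • (√v • g) ∂(stdGaussian E) =
      (v / (1 + v) * gaussDensity p (1 + v) (‖y‖ ^ 2)) • y := by
  rw [integral_stdGaussian]
  have e : ∀ g : E, gaussDensity p 1 (‖g‖ ^ 2) •
      gaussDensity p 1 (‖y - √v • g‖ ^ 2) • (√v • g) =
      (gaussDensity p (1 + v) (‖y‖ ^ 2) * √v) •
        gaussDensity p (1 / (1 + v)) (‖g - (√v / (1 + v)) • y‖ ^ 2) • g := fun g => by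
    rw [smul_smul, gaussDensity_mul_gaussDensity hv, smul_smul, smul_smul]
    congr 1
    ring
  simp_rw [e]
  rw [integral_smul, integral_gaussDensity_smul_id (by positivity), smul_smul]
  congr 1
  have : √v * √v = v := Real.mul_self_sqrt hv
  calc _ = (√v * √v) / (1 + v) * gaussDensity p (1 + v) (‖y‖ ^ 2) := by ring
    _ = _ := by rw [this]

theorem gaussDensity_le {s r : ℝ} (hs : 1 ≤ s) (hr : 0 ≤ r) :
    gaussDensity p s r ≤ 1 := by
  have h1 : (1 : ℝ) ≤ 2 * Real.pi * s := by nlinarith [Real.pi_gt_three]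
  refine mul_le_one₀ (Real.rpow_le_one_of_one_le_of_nonpos h1 ?_) (Real.exp_pos _).le
    (Real.exp_le_one_iff.2 ?_)
  · have : (0 : ℝ) ≤ p := Nat.cast_nonneg p
    linarith
  · exact div_nonpos_of_nonpos_of_nonneg (by linarith) (by linarith)

/-- A bound uniform in `θ`, so the posterior numerator converges under any finite prior without a
moment condition. -/
theorem gaussDensity_one_mul_norm_le (y θ : E) :
    gaussDensity p 1 (‖y - θ‖ ^ 2) * ‖θ‖ ≤ 1 + ‖y‖ := by
  have h1 : ‖θ‖ ≤ ‖y‖ + ‖y - θ‖ := by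
    have := norm_sub_le y (y - θ); simpa using this
  have h2 := gaussDensity_le (p := p) le_rfl (sq_nonneg ‖y - θ‖)
  have h3 : gaussDensity p 1 (‖y - θ‖ ^ 2) * ‖y - θ‖ ≤ 1 := by
    have hpi : (1 : ℝ) ≤ 2 * Real.pi * 1 := by nlinarith [Real.pi_gt_three]
    have hk : (2 * Real.pi * 1) ^ (-(p : ℝ) / 2) ≤ 1 :=
      Real.rpow_le_one_of_one_le_of_nonpos hpi
        (by have : (0 : ℝ) ≤ p := Nat.cast_nonneg p; linarith)
    have hx : ‖y - θ‖ ≤ Real.exp (‖y - θ‖ ^ 2 / 2) := by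
      nlinarith [Real.add_one_le_exp (‖y - θ‖ ^ 2 / 2), sq_nonneg (‖y - θ‖ - 1)]
    rw [gaussDensity, mul_assoc]
    refine mul_le_one₀ hk (by positivity) ?_
    calc Real.exp (-‖y - θ‖ ^ 2 / (2 * 1)) * ‖y - θ‖
        ≤ Real.exp (-‖y - θ‖ ^ 2 / (2 * 1)) * Real.exp (‖y - θ‖ ^ 2 / 2) :=
          mul_le_mul_of_nonneg_left hx (Real.exp_pos _).le
      _ = 1 := by 
        rw [← Real.exp_add, Real.exp_eq_one_iff]; ring
  have h4 := (gaussDensity_pos (p := p) one_pos (‖y - θ‖ ^ 2)).le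
  nlinarith [norm_nonneg y]

end GaussianDensity

/-! ### The Bayes rule of a Gaussian scale mixture -/

section BayesRule

variable {μ : Measure ℝ} [IsFiniteMeasure μ]

theorem integrable_gaussDensity_one_add (hμ : ∀ᵐ v ∂μ, 0 ≤ v) (p : ℕ) {u : ℝ} (hu : 0 ≤ u) :
    Integrable (fun v => gaussDensity p (1 + v) u) μ := by
  refine Integrable.of_bound (C := 1) ?_ ?_
  · exact Measurable.aestronglyMeasurable (by unfold gaussDensity; fun_prop)
  · filter_upwards [hμ] with v hv
    rw [Real.norm_of_nonneg (gaussDensity_pos (by linarith) _).le]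
    exact gaussDensity_le (by linarith) hu

/-- Fubini reduces numerator and denominator to the fixed-scale integrals, and `v / (1 + v) = 1 - 1
/ (1 + v)`. -/
theorem bayesRule_map_prod_stdGaussian {p : ℕ} (hμ : ∀ᵐ v ∂μ, 0 ≤ v) (h0 : μ ≠ 0)
    (y : EuclideanSpace ℝ (Fin p)) :
    bayesRule ((μ.prod (stdGaussian (EuclideanSpace ℝ (Fin p)))).map fun z => √z.1 • z.2) y =
      (1 - (∫ v, 1 / (1 + v) * gaussDensity p (1 + v) (‖y‖ ^ 2) ∂μ) /
        ∫ v, gaussDensity p (1 + v) (‖y‖ ^ 2) ∂μ) • y := by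
  have hmap : Measurable fun z : ℝ × EuclideanSpace ℝ (Fin p) => √z.1 • z.2 := by fun_prop
  have hD := integrable_gaussDensity_one_add hμ p (sq_nonneg ‖y‖)
  have hN : Integrable (fun v => 1 / (1 + v) * gaussDensity p (1 + v) (‖y‖ ^ 2)) μ := by
    refine hD.mono (Measurable.aestronglyMeasurable (by unfold gaussDensity; fun_prop)) ?_
    filter_upwards [hμ] with v hv
    rw [norm_mul]
    refine mul_le_of_le_one_left (norm_nonneg _) ?_
    rw [Real.norm_of_nonneg (by positivity), div_le_one (by linarith)]
    linarith
  have hpos : 0 < ∫ v, gaussDensity p (1 + v) (‖y‖ ^ 2) ∂μ := by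
    rw [integral_pos_iff_support_of_nonneg_ae _ hD]
    · rw [pos_iff_ne_zero]
      intro hz
      have : ∀ᵐ v ∂μ, False := by
        filter_upwards [hμ, measure_eq_zero_iff_ae_notMem.1 hz] with v hv hv'
        exact hv' (gaussDensity_pos (by linarith) _).ne'
      simp [h0] at this
    · filter_upwards [hμ] with v hv
      exact (gaussDensity_pos (by linarith) _).le
  have i1 : Integrable (fun z : ℝ × EuclideanSpace ℝ (Fin p) =>
      gaussDensity p 1 (‖y - √z.1 • z.2‖ ^ 2)) (μ.prod (stdGaussian _)) := by
    refine Integrable.of_bound (C := 1) (Measurable.aestronglyMeasurable (by fun_prop))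
      (Eventually.of_forall fun z => ?_)
    rw [Real.norm_of_nonneg (gaussDensity_pos one_pos _).le]
    exact gaussDensity_le le_rfl (sq_nonneg _)
  have i2 : Integrable (fun z : ℝ × EuclideanSpace ℝ (Fin p) =>
      gaussDensity p 1 (‖y - √z.1 • z.2‖ ^ 2) • (√z.1 • z.2)) (μ.prod (stdGaussian _)) := by
    refine Integrable.of_bound (C := 1 + ‖y‖) (Measurable.aestronglyMeasurable (by fun_prop))
      (Eventually.of_forall fun z => ?_)
    rw [norm_smul, Real.norm_of_nonneg (gaussDensity_pos one_pos _).le]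
    exact gaussDensity_one_mul_norm_le y _
  rw [bayesRule, integral_map hmap.aemeasurable (Continuous.aestronglyMeasurable (by fun_prop)),
    integral_map hmap.aemeasurable (Continuous.aestronglyMeasurable (by fun_prop)),
    integral_prod _ i1, integral_prod _ i2]
  have e1 : ∫ v, ∫ g, gaussDensity p 1 (‖y - √v • g‖ ^ 2) ∂(stdGaussian _) ∂μ =
      ∫ v, gaussDensity p (1 + v) (‖y‖ ^ 2) ∂μ :=
    integral_congr_ae (hμ.mono fun v hv => integral_gaussDensity_stdGaussian hv y)
  have e2 : ∫ v, ∫ g, gaussDensity p 1 (‖y - √v • g‖ ^ 2) • (√v • g) ∂(stdGaussian _) ∂μ =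
      ∫ v, (gaussDensity p (1 + v) (‖y‖ ^ 2) -
        1 / (1 + v) * gaussDensity p (1 + v) (‖y‖ ^ 2)) • y ∂μ := by
    refine integral_congr_ae (hμ.mono fun v hv => ?_)
    simp only
    rw [integral_gaussDensity_smul_stdGaussian hv y]
    congr 1
    have : 1 + v ≠ 0 := by linarith
    field_simp
    ring
  rw [e1, e2, integral_smul_const, integral_sub hD hN, smul_smul]
  congr 1
  field_simp

theorem gammaMixture_ne_zero {m : ℕ} (hm : 1 ≤ m) : gammaMixture m Set.univ ≠ 0 := by
  rw [gammaMixture, Measure.finsetSum_apply]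
  intro h
  have hk : 1 ∈ Finset.Icc 1 m := Finset.mem_Icc.2 ⟨le_rfl, hm⟩
  have h1 := Finset.sum_eq_zero_iff.1 h 1 hk
  have := isProbabilityMeasure_gammaMeasure_half hk
  rw [Measure.smul_apply, measure_univ] at h1
  simp only [smul_eq_mul, mul_one, ENNReal.div_eq_zero_iff, Nat.choose_one_right] at h1
  rcases h1 with h1 | h1
  · exact absurd (Nat.cast_eq_zero.1 h1) (by omega)
  · exact absurd h1 (by simp)

theorem varianceLaw_ne_zero {n : ℕ → ℕ} {σ : ℕ → ℝ} {d : ℕ} {x : EuclideanSpace ℝ (Fin (n 0))}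
    (hn : ∀ ℓ, 1 ≤ ℓ → ℓ < d → 1 ≤ n ℓ) : varianceLaw n σ d x ≠ 0 := by
  intro h
  have h1 : varianceLaw n σ d x Set.univ = 0 := by simp [h]
  rw [varianceLaw_eq_map, Measure.map_apply (by fun_prop) MeasurableSet.univ, Set.preimage_univ,
    Measure.pi_univ, Finset.prod_eq_zero_iff] at h1
  obtain ⟨i, -, hi⟩ := h1
  exact gammaMixture_ne_zero (hn (i + 1) (by omega) (by have := i.2; omega)) hi

theorem bnnRule_eq {d : ℕ} (hd : 1 ≤ d) {n : ℕ → ℕ} (hn : ∀ ℓ, 1 ≤ ℓ → ℓ < d → 1 ≤ n ℓ)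
    (hp : 1 ≤ n d) {σ : ℕ → ℝ} (hσ : ∀ ℓ, 1 ≤ ℓ → ℓ ≤ d → 0 < σ ℓ)
    {x : EuclideanSpace ℝ (Fin (n 0))} (hx : x ≠ 0) (y : EuclideanSpace ℝ (Fin (n d))) :
    bnnRule n σ d x y = (1 - psi n σ d x (‖y‖ ^ 2)) • y := by
  obtain ⟨e, rfl⟩ : ∃ e, d = e + 1 := ⟨d - 1, by omega⟩
  rw [bnnRule, prior_eq_map n σ e x hσ hx hp,
    bayesRule_map_prod_stdGaussian (ae_nonneg_varianceLaw n σ _ x) (varianceLaw_ne_zero hn), psi]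

end BayesRule

/-! ### Growth of the shrinkage function -/

/-- If `μ` charges `[K a ^ k, K (2 a) ^ k]` and `(K a ^ k, ∞)` with masses of exponential order in
`a`, then the posterior mean of `1 / (1 + v)` given `u` is at least of order
`u ^ (1 / (k + 1) - 1)`. -/
theorem exists_le_mul_integral_div_integral {μ : Measure ℝ} [IsFiniteMeasure μ]
    (hμ : ∀ᵐ v ∂μ, 0 ≤ v) (p k : ℕ) {K α β C : ℝ} (hK : 0 < K) (hα : 0 < α) (hβ : 0 ≤ β)
    (hC : 0 ≤ C)
    (hlow : ∀ a : ℝ, 1 ≤ a → α * Real.exp (-(β * a)) ≤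
      μ.real (Set.Icc (K * a ^ k) (K * (2 * a) ^ k)))
    (hup : ∀ a : ℝ, 1 ≤ a → μ.real (Set.Ioi (K * a ^ k)) ≤ C * Real.exp (-(a / 2))) :
    ∃ c : ℝ, 0 < c ∧ ∀ u : ℝ, 1 ≤ u → c * u ^ (1 / ((k + 1 : ℕ) : ℝ)) ≤
      u * ((∫ v, 1 / (1 + v) * gaussDensity p (1 + v) u ∂μ) /
        ∫ v, gaussDensity p (1 + v) u ∂μ) := by
  -- On the window `G` below, `a ^ k ≤ k! * exp a` gives `2π (1 + v) ≤ A * exp a`: the polynomial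
  -- normalising factor is absorbed into the exponential rate.
  set A : ℝ := 2 * Real.pi * (1 + K * 2 ^ k) * (k.factorial : ℝ) with hA
  have hApos : 0 < A := by positivity
  set A' : ℝ := A ^ (-(p : ℝ) / 2) * α with hA'
  have hA'pos : 0 < A' := mul_pos (Real.rpow_pos_of_pos hApos _) hα
  set β' : ℝ := p / 2 + 1 / (2 * K) + β with hβ'
  have hβ'0 : 0 ≤ β' := by positivity
  -- For `a ≥ 1` this gives `M a / 2 ≥ β' a + C / A'`, which makes the tail beyond `K (M a) ^ k`
  -- weigh no more than the window `G`. Also `M ≥ 2`, so `G` lies below that tail.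
  set M : ℝ := 2 * (β' + C / A') + 2 with hM
  have hCA : 0 ≤ C / A' := by positivity
  have hM2 : 2 ≤ M := by linarith
  refine ⟨1 / (2 * (1 + K * M ^ k)), by positivity, fun u hu => ?_⟩
  have hu0 : 0 ≤ u := by linarith
  -- The balancing scale: at `v = K a ^ k` the ratio `u / v` is `a / K`, of the same order as the
  -- tail exponent.
  set a : ℝ := u ^ (1 / ((k + 1 : ℕ) : ℝ)) with ha
  have ha1 : 1 ≤ a := Real.one_le_rpow hu (by positivity)
  have hau : a ^ (k + 1) = u := by
    rw [ha, ← Real.rpow_mul_natCast hu0, one_div, inv_mul_cancel₀ (by positivity), Real.rpow_one]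
  set w : ℝ → ℝ := fun v => gaussDensity p (1 + v) u with hw
  have hint : Integrable w μ := integrable_gaussDensity_one_add hμ p hu0
  have hwpos : ∀ v, 0 ≤ v → 0 < w v := fun v hv => gaussDensity_pos (by linarith) _
  have hint' : Integrable (fun v => 1 / (1 + v) * w v) μ := by
    refine hint.mono (Measurable.aestronglyMeasurable
      (by simp only [hw]; unfold gaussDensity; fun_prop)) ?_
    filter_upwards [hμ] with v hv
    rw [norm_mul]
    refine mul_le_of_le_one_left (norm_nonneg _) ?_
    rw [Real.norm_of_nonneg (by positivity), div_le_one (by linarith)]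
    linarith
  set G : Set ℝ := Set.Icc (K * a ^ k) (K * (2 * a) ^ k) with hG
  set B : Set ℝ := Set.Ioi (K * (M * a) ^ k) with hB
  have hBm : MeasurableSet B := measurableSet_Ioi
  have hGm : MeasurableSet G := measurableSet_Icc
  have hak1 : 1 ≤ a ^ k := one_le_pow₀ ha1
  have hwG : ∀ v ∈ G, A ^ (-(p : ℝ) / 2) * Real.exp (-((p / 2 + 1 / (2 * K)) * a)) ≤ w v := by
    intro v hv
    have hv0 : 0 < v := lt_of_lt_of_le (by positivity) hv.1
    have hfac : a ^ k ≤ k.factorial * Real.exp a := by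
      have := Real.pow_div_factorial_le_exp a (by linarith) k
      rwa [div_le_iff₀ (by positivity), mul_comm] at this
    have h1 : 2 * Real.pi * (1 + v) ≤ A * Real.exp a := by
      have h2 : 1 + v ≤ (1 + K * 2 ^ k) * a ^ k := by
        have := hv.2
        rw [mul_pow] at this
        nlinarith
      calc 2 * Real.pi * (1 + v)
          ≤ 2 * Real.pi * ((1 + K * 2 ^ k) * (k.factorial * Real.exp a)) := by
            gcongr
            exact h2.trans (by gcongr)
        _ = _ := by rw [hA]; ring
    have h3 : A ^ (-(p : ℝ) / 2) * Real.exp (-(p / 2 * a)) ≤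
        (2 * Real.pi * (1 + v)) ^ (-(p : ℝ) / 2) := by
      have h4 : A ^ (-(p : ℝ) / 2) * Real.exp (-(p / 2 * a)) =
          (A * Real.exp a) ^ (-(p : ℝ) / 2) := by
        rw [Real.mul_rpow hApos.le (Real.exp_pos _).le, ← Real.exp_mul]
        congr 2; ring
      rw [h4]
      exact Real.rpow_le_rpow_of_nonpos (by positivity) h1
        (by have : (0 : ℝ) ≤ p := Nat.cast_nonneg p; linarith)
    have h5 : Real.exp (-(1 / (2 * K) * a)) ≤ Real.exp (-u / (2 * (1 + v))) := by
      rw [Real.exp_le_exp, neg_div, neg_le_neg_iff, div_le_iff₀ (by positivity), ← hau, pow_succ]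
      have h6 : a ^ k ≤ (1 + v) / K := by
        rw [le_div_iff₀ hK]
        linarith [hv.1]
      calc a ^ k * a ≤ (1 + v) / K * a := by gcongr
        _ = _ := by field_simp
    calc A ^ (-(p : ℝ) / 2) * Real.exp (-((p / 2 + 1 / (2 * K)) * a))
        = (A ^ (-(p : ℝ) / 2) * Real.exp (-(p / 2 * a))) * Real.exp (-(1 / (2 * K) * a)) := by
          rw [mul_assoc, ← Real.exp_add]; ring_nf
      _ ≤ _ := by
          simp only [hw, gaussDensity]
          gcongr
  have hGint : A' * Real.exp (-(β' * a)) ≤ ∫ v in G, w v ∂μ := by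
    have h1 : ∫ v in G, A ^ (-(p : ℝ) / 2) * Real.exp (-((p / 2 + 1 / (2 * K)) * a)) ∂μ ≤
        ∫ v in G, w v ∂μ :=
      setIntegral_mono_on (integrable_const _).integrableOn hint.integrableOn hGm hwG
    rw [setIntegral_const, smul_eq_mul] at h1
    refine le_trans ?_ h1
    calc A' * Real.exp (-(β' * a)) = (α * Real.exp (-(β * a))) *
          (A ^ (-(p : ℝ) / 2) * Real.exp (-((p / 2 + 1 / (2 * K)) * a))) := by
          have : Real.exp (-(β' * a)) =
              Real.exp (-(β * a)) * Real.exp (-((p / 2 + 1 / (2 * K)) * a)) := by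
            rw [← Real.exp_add, hβ']; ring_nf
          rw [this, hA']; ring
      _ ≤ _ := by
          gcongr
          exact hlow a ha1
  have hBint : ∫ v in B, w v ∂μ ≤ A' * Real.exp (-(β' * a)) := by
    have h1 : ∫ v in B, w v ∂μ ≤ ∫ v in B, (1 : ℝ) ∂μ :=
      setIntegral_mono_on_ae hint.integrableOn (integrable_const _).integrableOn hBm
        (hμ.mono fun v hv _ => gaussDensity_le (by linarith) hu0)
    rw [setIntegral_const, smul_eq_mul, mul_one] at h1
    refine h1.trans ((hup (M * a) (by nlinarith)).trans ?_)
    have h2 : C * Real.exp (-(C / A')) ≤ A' := by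
      have h3 : C / A' ≤ Real.exp (C / A') := by linarith [Real.add_one_le_exp (C / A')]
      rw [div_le_iff₀ hA'pos] at h3
      rw [Real.exp_neg, ← div_eq_mul_inv, div_le_iff₀ (Real.exp_pos _)]
      linarith
    calc C * Real.exp (-(M * a / 2)) ≤ C * Real.exp (-(C / A') + -(β' * a)) := by
          gcongr
          nlinarith
      _ = (C * Real.exp (-(C / A'))) * Real.exp (-(β' * a)) := by rw [Real.exp_add, mul_assoc]
      _ ≤ _ := by gcongr
  have hGB : ∫ v in G, w v ∂μ ≤ ∫ v in Bᶜ, w v ∂μ := by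
    refine setIntegral_mono_set hint.integrableOn
      (ae_restrict_of_ae (hμ.mono fun v hv => (hwpos v hv).le)) ?_
    refine Eventually.of_forall fun v hv => ?_
    have : (2 * a) ^ k ≤ (M * a) ^ k := by gcongr
    have hle : v ≤ K * (M * a) ^ k := hv.2.trans (by gcongr)
    exact not_lt.2 hle
  have hsplit := integral_add_compl hBm hint
  set I := ∫ v in Bᶜ, w v ∂μ with hI
  have hIpos : 0 < I := lt_of_lt_of_le (by positivity) (hGint.trans hGB)
  -- At least half of the posterior mass lies off the tail, where `1 / (1 + v)` is bounded below.
  have hD : ∫ v, w v ∂μ ≤ 2 * I := by linarith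
  have hDpos : 0 < ∫ v, w v ∂μ := by
    have : 0 ≤ ∫ v in B, w v ∂μ :=
      integral_nonneg_of_ae (ae_restrict_of_ae (hμ.mono fun v hv => (hwpos v hv).le))
    linarith
  have hN : I / (1 + K * (M * a) ^ k) ≤ ∫ v, 1 / (1 + v) * w v ∂μ := by
    calc I / (1 + K * (M * a) ^ k) = ∫ v in Bᶜ, 1 / (1 + K * (M * a) ^ k) * w v ∂μ := by
          rw [integral_const_mul]; ring
      _ ≤ ∫ v in Bᶜ, 1 / (1 + v) * w v ∂μ := by
          refine setIntegral_mono_on_ae (hint.const_mul _).integrableOn hint'.integrableOn hBm.compl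
            (hμ.mono fun v hv hvB => ?_)
          have h1 : v ≤ K * (M * a) ^ k := not_lt.1 hvB
          exact mul_le_mul_of_nonneg_right
            (one_div_le_one_div_of_le (by linarith) (by linarith)) (hwpos v hv).le
      _ ≤ _ := setIntegral_le_integral hint'
          (hμ.mono fun v hv => mul_nonneg (by positivity) (hwpos v hv).le)
  have hden : 1 + K * (M * a) ^ k ≤ (1 + K * M ^ k) * a ^ k := by
    rw [mul_pow]; nlinarith
  have hKM : 0 < 1 + K * M ^ k := by positivity
  have hratio : 1 / (2 * ((1 + K * M ^ k) * a ^ k)) ≤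
      (∫ v, 1 / (1 + v) * w v ∂μ) / ∫ v, w v ∂μ := by
    rw [le_div_iff₀ hDpos]
    refine le_trans ?_ hN
    calc 1 / (2 * ((1 + K * M ^ k) * a ^ k)) * ∫ v, w v ∂μ
        ≤ 1 / (2 * ((1 + K * M ^ k) * a ^ k)) * (2 * I) := by gcongr
      _ = I / ((1 + K * M ^ k) * a ^ k) := by field_simp
      _ ≤ _ := by gcongr
  calc 1 / (2 * (1 + K * M ^ k)) * a = u * (1 / (2 * ((1 + K * M ^ k) * a ^ k))) := by
        rw [← hau, pow_succ]; field_simp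
    _ ≤ _ := by gcongr

/-- The component `k = 1` alone suffices: its density decreases, so the mass is at least the length
`a` times the density at `2 a`. -/
theorem exists_gammaMixture_Icc_ge {m : ℕ} (hm : 1 ≤ m) :
    ∃ α : ℝ, 0 < α ∧ ∀ a : ℝ, 1 ≤ a →
      α * Real.exp (-(2 * a)) ≤ (gammaMixture m).real (Set.Icc a (2 * a)) := by
  have hk : 1 ∈ Finset.Icc 1 m := Finset.mem_Icc.2 ⟨le_rfl, hm⟩
  have := isProbabilityMeasure_gammaMeasure_half hk
  have hG : 0 < Real.Gamma (1 / 2) := Real.Gamma_pos_of_pos (by norm_num)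
  refine ⟨(m : ℝ) / 2 ^ m * (1 / Real.Gamma (1 / 2) * 2 ^ (-(1 / 2) : ℝ)), by positivity,
    fun a ha => ?_⟩
  have h1 : ((m.choose 1 : ℝ≥0∞) / 2 ^ m) • gammaMeasure (((1 : ℕ) : ℝ) / 2) 1 ≤ gammaMixture m :=
    Measure.le_iff.2 fun s hs => by
      rw [gammaMixture, Measure.finsetSum_apply]
      exact Finset.single_le_sum (f := fun k => (((m.choose k : ℝ≥0∞) / 2 ^ m) •
        gammaMeasure ((k : ℝ) / 2) 1) s) (fun _ _ => zero_le) hk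
  have h2 : (m : ℝ) / 2 ^ m * (gammaMeasure (((1 : ℕ) : ℝ) / 2) 1).real (Set.Icc a (2 * a)) ≤
      (gammaMixture m).real (Set.Icc a (2 * a)) := by
    have := ENNReal.toReal_mono (measure_ne_top _ _) (h1 (Set.Icc a (2 * a)))
    simpa [Measure.real, ENNReal.toReal_mul, ENNReal.toReal_div] using this
  refine le_trans ?_ h2
  rw [mul_assoc]
  refine mul_le_mul_of_nonneg_left ?_ (by positivity)
  have h3 : (gammaMeasure (((1 : ℕ) : ℝ) / 2) 1).real (Set.Icc a (2 * a)) =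
      ∫ x in Set.Ioi 0, (1 / Real.Gamma (1 / 2) * x ^ ((1 / 2 : ℝ) - 1) * Real.exp (-x)) *
        (Set.Icc a (2 * a)).indicator 1 x := by
    rw [← integral_indicator_one measurableSet_Icc, integral_gammaMeasure (by norm_num)]
    simp
  have h4 : ∫ x in Set.Ioi 0, (1 / Real.Gamma (1 / 2) * x ^ ((1 / 2 : ℝ) - 1) * Real.exp (-x)) *
        (Set.Icc a (2 * a)).indicator 1 x =
      ∫ x in Set.Icc a (2 * a), 1 / Real.Gamma (1 / 2) * x ^ ((1 / 2 : ℝ) - 1) * Real.exp (-x) := by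
    rw [← integral_indicator measurableSet_Icc, ← integral_indicator measurableSet_Ioi]
    congr 1
    ext x
    by_cases hx : x ∈ Set.Icc a (2 * a)
    · have : x ∈ Set.Ioi (0 : ℝ) := lt_of_lt_of_le (by linarith) hx.1
      simp [hx, Set.indicator_of_mem this]
    · rw [Set.indicator_of_notMem hx, Set.indicator_apply]
      simp [Set.indicator_of_notMem hx]
  have h5 : ∀ x ∈ Set.Icc a (2 * a), 1 / Real.Gamma (1 / 2) * (2 * a) ^ (-(1 / 2) : ℝ) *
      Real.exp (-(2 * a)) ≤ 1 / Real.Gamma (1 / 2) * x ^ ((1 / 2 : ℝ) - 1) * Real.exp (-x) := by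
    intro x hx
    have hx0 : 0 < x := lt_of_lt_of_le (by linarith) hx.1
    have : (1 / 2 : ℝ) - 1 = -(1 / 2) := by norm_num
    rw [this]
    have h6 : (2 * a) ^ (-(1 / 2) : ℝ) ≤ x ^ (-(1 / 2) : ℝ) :=
      Real.rpow_le_rpow_of_nonpos hx0 hx.2 (by norm_num)
    have h7 : Real.exp (-(2 * a)) ≤ Real.exp (-x) := Real.exp_le_exp.2 (by linarith [hx.2])
    gcongr
  have h8 : ContinuousOn (fun x : ℝ => 1 / Real.Gamma (1 / 2) * x ^ ((1 / 2 : ℝ) - 1) *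
      Real.exp (-x)) (Set.Icc a (2 * a)) := by
    refine (continuousOn_const.mul (continuousOn_id.rpow_const fun x hx => Or.inl ?_)).mul
      (by fun_prop)
    exact (lt_of_lt_of_le (by linarith) hx.1 : (0 : ℝ) < x).ne'
  have h9 := setIntegral_mono_on (integrableOn_const (μ := (volume : Measure ℝ)) (by simp))
    (h8.integrableOn_compact isCompact_Icc) measurableSet_Icc h5
  rw [setIntegral_const, smul_eq_mul, Real.volume_real_Icc_of_le (by linarith)] at h9
  rw [h3, h4]
  refine le_trans ?_ h9
  have h10 : (2 : ℝ) ^ (-(1 / 2) : ℝ) ≤ (2 * a - a) * (2 * a) ^ (-(1 / 2) : ℝ) := by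
    rw [Real.mul_rpow (by norm_num) (by linarith)]
    have : 1 ≤ a * a ^ (-(1 / 2) : ℝ) := by
      nth_rewrite 1 [← Real.rpow_one a]
      rw [← Real.rpow_add (by linarith)]
      exact Real.one_le_rpow ha (by norm_num)
    have h2 : 0 < (2 : ℝ) ^ (-(1 / 2) : ℝ) := by positivity
    nlinarith
  calc 1 / Real.Gamma (1 / 2) * 2 ^ (-(1 / 2) : ℝ) * Real.exp (-(2 * a))
      ≤ 1 / Real.Gamma (1 / 2) * ((2 * a - a) * (2 * a) ^ (-(1 / 2) : ℝ)) *
          Real.exp (-(2 * a)) := by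
        gcongr
    _ = _ := by ring

/-- Chernoff's bound at parameter `1/2`. -/
theorem gammaMixture_Ioi_le (m : ℕ) (a : ℝ) :
    (gammaMixture m).real (Set.Ioi a) ≤
      (∫ x, Real.exp (1 / 2 * x) ∂(gammaMixture m)) * Real.exp (-(a / 2)) := by
  have h := measure_ge_le_exp_mul_mgf (μ := gammaMixture m) (X := id) (t := 1 / 2) a (by norm_num)
    (integrable_exp_gammaMixture m (by norm_num))
  have h1 : (gammaMixture m).real (Set.Ioi a) ≤ (gammaMixture m).real {x | a ≤ id x} :=
    measureReal_mono fun x hx => le_of_lt (Set.mem_Ioi.1 hx)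
  refine h1.trans (h.trans (le_of_eq ?_))
  rw [mgf, mul_comm]
  congr 2
  ring

/-- It is enough that every Gamma factor lies in `[a, 2 a]`; independence multiplies the bounds. -/
theorem exists_varianceLaw_Icc_ge {n : ℕ → ℕ} (σ : ℕ → ℝ) {d : ℕ}
    (x : EuclideanSpace ℝ (Fin (n 0))) (hn : ∀ ℓ, 1 ≤ ℓ → ℓ < d → 1 ≤ n ℓ) :
    ∃ α : ℝ, 0 < α ∧ ∀ a : ℝ, 1 ≤ a → α * Real.exp (-(2 * (d - 1 : ℕ) * a)) ≤
      (varianceLaw n σ d x).real (Set.Icc (varianceScale n σ d x * a ^ (d - 1))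
        (varianceScale n σ d x * (2 * a) ^ (d - 1))) := by
  have hex : ∀ i : Fin (d - 1), ∃ α : ℝ, 0 < α ∧ ∀ a : ℝ, 1 ≤ a →
      α * Real.exp (-(2 * a)) ≤ (gammaMixture (n ((i : ℕ) + 1))).real (Set.Icc a (2 * a)) :=
    fun i => exists_gammaMixture_Icc_ge (hn (i + 1) (by omega) (by have := i.2; omega))
  choose α hα hαle using hex
  have hK := varianceScale_nonneg n σ d x
  refine ⟨∏ i, α i, Finset.prod_pos fun i _ => hα i, fun a ha => ?_⟩
  have h1 : (Measure.pi fun i : Fin (d - 1) => gammaMixture (n ((i : ℕ) + 1))).real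
      (Set.univ.pi fun _ => Set.Icc a (2 * a)) =
      ∏ i : Fin (d - 1), (gammaMixture (n ((i : ℕ) + 1))).real (Set.Icc a (2 * a)) := by
    rw [Measure.real, Measure.pi_pi, ENNReal.toReal_prod]
    rfl
  have h2 : (∏ i, α i) * Real.exp (-(2 * (d - 1 : ℕ) * a)) ≤
      ∏ i : Fin (d - 1), (gammaMixture (n ((i : ℕ) + 1))).real (Set.Icc a (2 * a)) := by
    have : Real.exp (-(2 * (d - 1 : ℕ) * a)) = ∏ _i : Fin (d - 1), Real.exp (-(2 * a)) := by
      rw [Finset.prod_const, Finset.card_univ, Fintype.card_fin, ← Real.exp_nat_mul]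
      ring_nf
    rw [this, ← Finset.prod_mul_distrib]
    exact Finset.prod_le_prod (fun i _ => mul_nonneg (hα i).le (Real.exp_pos _).le)
      fun i _ => hαle i a ha
  refine h2.trans (h1 ▸ ?_)
  rw [varianceLaw_eq_map, map_measureReal_apply (by fun_prop) measurableSet_Icc]
  refine measureReal_mono fun t ht => ?_
  have ht' : ∀ i, t i ∈ Set.Icc a (2 * a) := fun i => ht i (Set.mem_univ i)
  have e : ∀ b : ℝ, b ^ (d - 1) = ∏ _i : Fin (d - 1), b := fun b => by simp
  rw [e, e]
  exact ⟨mul_le_mul_of_nonneg_left (Finset.prod_le_prod (fun i _ => by linarith)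
      fun i _ => (ht' i).1) hK,
    mul_le_mul_of_nonneg_left (Finset.prod_le_prod (fun i _ => by linarith [(ht' i).1])
      fun i _ => (ht' i).2) hK⟩

/-- A product of `d - 1` positive factors exceeds `a ^ (d - 1)` only if some factor exceeds `a`; a
union bound follows. For `d = 1` the sum is empty and the constant is 0. -/
theorem exists_varianceLaw_Ioi_le (n : ℕ → ℕ) (σ : ℕ → ℝ) (d : ℕ)
    (x : EuclideanSpace ℝ (Fin (n 0))) :
    ∃ C : ℝ, 0 ≤ C ∧ ∀ a : ℝ, 1 ≤ a →
      (varianceLaw n σ d x).real (Set.Ioi (varianceScale n σ d x * a ^ (d - 1))) ≤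
        C * Real.exp (-(a / 2)) := by
  set μ : Fin (d - 1) → Measure ℝ := fun i => gammaMixture (n ((i : ℕ) + 1)) with hμ
  have hfin : ∀ i, IsFiniteMeasure (μ i) := fun i => by simp only [hμ]; infer_instance
  have hK := varianceScale_nonneg n σ d x
  refine ⟨∑ i, (∏ j ∈ Finset.univ.erase i, μ j Set.univ).toReal * ∫ x, Real.exp (1 / 2 * x) ∂(μ i),
    Finset.sum_nonneg fun i _ => mul_nonneg ENNReal.toReal_nonneg
      (integral_nonneg fun _ => (Real.exp_pos _).le), fun a ha => ?_⟩
  rw [varianceLaw_eq_map, map_measureReal_apply (by fun_prop) measurableSet_Ioi]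
  have hsub : (Measure.pi μ).real ((fun t => varianceScale n σ d x * ∏ i, t i) ⁻¹'
      Set.Ioi (varianceScale n σ d x * a ^ (d - 1))) ≤
      (Measure.pi μ).real (⋃ i ∈ (Finset.univ : Finset (Fin (d - 1))),
        Function.eval i ⁻¹' Set.Ioi a) := by
    refine ENNReal.toReal_mono (measure_ne_top _ _) (measure_mono_ae ?_)
    filter_upwards [ae_pos_pi_gammaMixture fun i : Fin (d - 1) => n ((i : ℕ) + 1)] with t ht h
    by_contra hcon
    have hle : ∀ i, t i ≤ a := fun i => by
      by_contra hi
      exact hcon (Set.mem_iUnion₂.2 ⟨i, Finset.mem_univ i, not_le.1 hi⟩)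
    have : ∏ i, t i ≤ a ^ (d - 1) := by
      have := Finset.prod_le_prod (s := Finset.univ) (fun i _ => (ht i).le) fun i _ => hle i
      simpa using this
    exact absurd (Set.mem_Ioi.1 h) (not_lt.2 (mul_le_mul_of_nonneg_left this hK))
  refine hsub.trans ((measureReal_biUnion_finset_le _ _).trans ?_)
  rw [Finset.sum_mul]
  refine Finset.sum_le_sum fun i _ => ?_
  rw [← map_measureReal_apply (measurable_pi_apply i) measurableSet_Ioi, Measure.pi_map_eval]
  rw [measureReal_ennreal_smul_apply, mul_assoc]
  exact mul_le_mul_of_nonneg_left (gammaMixture_Ioi_le _ a) ENNReal.toReal_nonneg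

theorem exists_le_mul_psi {d : ℕ} (hd : 1 ≤ d) {n : ℕ → ℕ}
    (hn : ∀ ℓ, 1 ≤ ℓ → ℓ < d → 1 ≤ n ℓ) {σ : ℕ → ℝ} (hσ : ∀ ℓ, 1 ≤ ℓ → ℓ ≤ d → 0 < σ ℓ)
    {x : EuclideanSpace ℝ (Fin (n 0))} (hx : x ≠ 0) :
    ∃ c : ℝ, 0 < c ∧ ∀ u : ℝ, 1 ≤ u → c * u ^ (1 / (d : ℝ)) ≤ u * psi n σ d x u := by
  obtain ⟨α, hα, hlow⟩ := exists_varianceLaw_Icc_ge σ x hn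
  obtain ⟨C, hC, hup⟩ := exists_varianceLaw_Ioi_le n σ d x
  have := exists_le_mul_integral_div_integral (ae_nonneg_varianceLaw n σ d x) (n d) (d - 1)
    (varianceScale_pos hσ hx) hα (by positivity) hC hlow hup
  rwa [Nat.sub_add_cancel hd] at this

/-! ### Regularity of the shrinkage function -/

section Shrinkage

variable {μ : Measure ℝ} (p : ℕ)

theorem rpow_two_pi_one_add_le_one {v : ℝ} (hv : 0 ≤ v) :
    (2 * Real.pi * (1 + v)) ^ (-(p : ℝ) / 2) ≤ 1 := by
  refine Real.rpow_le_one_of_one_le_of_nonpos (by nlinarith [Real.pi_gt_three]) ?_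
  have : (0 : ℝ) ≤ p := Nat.cast_nonneg p
  linarith

variable (μ) in
/-- The mixing law weighted by the normalising constants of the Gaussian densities. -/
noncomputable def weightedLaw : Measure ℝ :=
  μ.withDensity fun v => ENNReal.ofReal ((2 * Real.pi * (1 + v)) ^ (-(p : ℝ) / 2))

theorem weightedLaw_absolutelyContinuous : weightedLaw μ p ≪ μ :=
  withDensity_absolutelyContinuous _ _

theorem isFiniteMeasure_weightedLaw [IsFiniteMeasure μ] (hμ : ∀ᵐ v ∂μ, 0 ≤ v) :
    IsFiniteMeasure (weightedLaw μ p) := by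
  refine isFiniteMeasure_withDensity_ofReal (Integrable.of_bound (C := 1)
    (Measurable.aestronglyMeasurable (by fun_prop)) ?_).2
  filter_upwards [hμ] with v hv
  rw [Real.norm_of_nonneg (by positivity)]
  exact rpow_two_pi_one_add_le_one p hv

theorem weightedLaw_ne_zero (hμ : ∀ᵐ v ∂μ, 0 ≤ v) (h0 : μ ≠ 0) : weightedLaw μ p ≠ 0 := by
  intro h
  rw [weightedLaw, withDensity_eq_zero_iff (by fun_prop)] at h
  have : ∀ᵐ v ∂μ, False := by
    filter_upwards [hμ, h] with v hv h
    have : 0 < (2 * Real.pi * (1 + v)) ^ (-(p : ℝ) / 2) := by positivity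
    simp only [Pi.zero_apply, ENNReal.ofReal_eq_zero] at h
    linarith
  simp [h0] at this

theorem integral_weightedLaw (hμ : ∀ᵐ v ∂μ, 0 ≤ v) (f : ℝ → ℝ) :
    ∫ v, f v ∂(weightedLaw μ p) =
      ∫ v, (2 * Real.pi * (1 + v)) ^ (-(p : ℝ) / 2) * f v ∂μ := by
  rw [weightedLaw, integral_withDensity_eq_integral_toReal_smul (by fun_prop) (by simp)]
  refine integral_congr_ae (hμ.mono fun v hv => ?_)
  simp only [smul_eq_mul]
  rw [ENNReal.toReal_ofReal (by positivity)]

theorem ae_weightedLaw (hμ : ∀ᵐ v ∂μ, 0 ≤ v) :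
    ∀ᵐ v ∂(weightedLaw μ p), 0 < 1 / (1 + v) ∧ 1 / (1 + v) ≤ 1 := by
  filter_upwards [(weightedLaw_absolutelyContinuous p).ae_le hμ] with v hv
  exact ⟨by positivity, by rw [div_le_one (by linarith)]; linarith⟩

theorem integrableExpSet_weightedLaw [IsFiniteMeasure μ] (hμ : ∀ᵐ v ∂μ, 0 ≤ v) :
    integrableExpSet (fun v : ℝ => 1 / (1 + v)) (weightedLaw μ p) = Set.univ := by
  have := isFiniteMeasure_weightedLaw p hμ
  refine Set.eq_univ_of_forall fun t => ?_
  refine Integrable.of_bound (C := Real.exp |t|) (Measurable.aestronglyMeasurable (by fun_prop)) ?_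
  filter_upwards [ae_weightedLaw p hμ] with v hv
  rw [Real.norm_of_nonneg (Real.exp_pos _).le, Real.exp_le_exp]
  refine (le_abs_self _).trans ?_
  rw [abs_mul, abs_of_pos hv.1]
  exact mul_le_of_le_one_right (abs_nonneg t) hv.2

variable (μ) in
/-- The posterior mean of `1 / (1 + v)` given `u` under the mixing law `μ`. -/
noncomputable def shrinkage (u : ℝ) : ℝ :=
  (∫ v, 1 / (1 + v) * gaussDensity p (1 + v) u ∂μ) / ∫ v, gaussDensity p (1 + v) u ∂μ

/-- In `X = 1 / (1 + v)` the likelihood is an exponential tilt of parameter `-u / 2`, so the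
posterior mean of `X` is a derivative of its cumulant generating function. The derivative in `u` is
then minus half the tilted variance. -/
theorem shrinkage_eq_deriv_cgf [IsFiniteMeasure μ] (hμ : ∀ᵐ v ∂μ, 0 ≤ v) (u : ℝ) :
    shrinkage μ p u =
      deriv (cgf (fun v : ℝ => 1 / (1 + v)) (weightedLaw μ p)) (-(1 / 2) * u) := by
  rw [deriv_cgf (by rw [integrableExpSet_weightedLaw p hμ, interior_univ]; trivial), mgf,
    integral_weightedLaw p hμ,
    integral_weightedLaw p hμ, shrinkage]
  have e : ∀ᵐ v ∂μ, gaussDensity p (1 + v) u =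
      (2 * Real.pi * (1 + v)) ^ (-(p : ℝ) / 2) * Real.exp (-(1 / 2) * u * (1 / (1 + v))) := by
    filter_upwards [hμ] with v hv
    rw [gaussDensity]
    congr 2
    have : 1 + v ≠ 0 := by linarith
    field_simp
  congr 1
  · refine integral_congr_ae (e.mono fun v hv => ?_)
    simp only [hv]
    ring
  · exact integral_congr_ae e

/-- The shrinkage function takes values in `(0, 1]`, decreases, and has a bounded derivative. -/
theorem exists_hasDerivAt_shrinkage [IsFiniteMeasure μ] (hμ : ∀ᵐ v ∂μ, 0 ≤ v) (h0 : μ ≠ 0) :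
    (∀ u, 0 < shrinkage μ p u ∧ shrinkage μ p u ≤ 1) ∧
      ∀ u, HasDerivAt (shrinkage μ p) (deriv (shrinkage μ p) u) u ∧
        -1 ≤ deriv (shrinkage μ p) u ∧ deriv (shrinkage μ p) u ≤ 0 := by
  set X : ℝ → ℝ := fun v => 1 / (1 + v) with hX
  set ρ := weightedLaw μ p with hρ
  have hfin : IsFiniteMeasure ρ := isFiniteMeasure_weightedLaw p hμ
  have hρ0 : ρ ≠ 0 := weightedLaw_ne_zero p hμ h0
  have hset : integrableExpSet X ρ = Set.univ := integrableExpSet_weightedLaw p hμ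
  have hmem : ∀ t, t ∈ interior (integrableExpSet X ρ) := fun t => by simp [hset]
  have hint : ∀ t, Integrable (fun v => Real.exp (t * X v)) ρ := fun t =>
    interior_subset (s := integrableExpSet X ρ) (hmem t)
  have hXm : Measurable X := by simp only [hX]; fun_prop
  have hae : ∀ᵐ v ∂ρ, 0 < X v ∧ X v ≤ 1 := ae_weightedLaw p hμ
  have hfun : shrinkage μ p = fun u => deriv (cgf X ρ) (-(1 / 2) * u) :=
    funext (shrinkage_eq_deriv_cgf p hμ)
  have hmgf : ∀ t, 0 < mgf X ρ t := fun t => mgf_pos' hρ0 (hint t)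
  have hint1 : ∀ t, Integrable (fun v => X v * Real.exp (t * X v)) ρ := fun t => by
    refine (hint t).mono (Measurable.aestronglyMeasurable (by fun_prop)) ?_
    filter_upwards [hae] with v hv
    rw [norm_mul, Real.norm_of_nonneg hv.1.le]
    exact mul_le_of_le_one_left (norm_nonneg _) hv.2
  have hint2 : ∀ t, Integrable (fun v => X v ^ 2 * Real.exp (t * X v)) ρ := fun t => by
    refine (hint t).mono (Measurable.aestronglyMeasurable (by fun_prop)) ?_
    filter_upwards [hae] with v hv
    rw [norm_mul, Real.norm_of_nonneg (sq_nonneg _)]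
    exact mul_le_of_le_one_left (norm_nonneg _) (pow_le_one₀ hv.1.le hv.2)
  -- The tilted variance of a variable with values in `(0, 1]`.
  have hsecond : ∀ t, 0 ≤ iteratedDeriv 2 (cgf X ρ) t ∧ iteratedDeriv 2 (cgf X ρ) t ≤ 1 := by
    intro t
    constructor
    · rw [iteratedDeriv_two_cgf_eq_integral (hmem t)]
      exact div_nonneg (integral_nonneg fun v => by positivity) (hmgf t).le
    · rw [iteratedDeriv_two_cgf (hmem t)]
      have : (∫ v, X v ^ 2 * Real.exp (t * X v) ∂ρ) / mgf X ρ t ≤ 1 := by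
        rw [div_le_one (hmgf t), mgf]
        refine integral_mono_ae (hint2 t) (hint t) (hae.mono fun v hv => ?_)
        exact mul_le_of_le_one_left (Real.exp_pos _).le (pow_le_one₀ hv.1.le hv.2)
      linarith [sq_nonneg (deriv (cgf X ρ) t)]
  have hder : ∀ u, HasDerivAt (shrinkage μ p)
      (iteratedDeriv 2 (cgf X ρ) (-(1 / 2) * u) * (-(1 / 2))) u := by
    intro u
    rw [hfun]
    have h1 : HasDerivAt (deriv (cgf X ρ)) (iteratedDeriv 2 (cgf X ρ) (-(1 / 2) * u))
        (-(1 / 2) * u) := by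
      rw [iteratedDeriv_succ, iteratedDeriv_one]
      exact (analyticAt_cgf (hmem _)).deriv.differentiableAt.hasDerivAt
    have h2 : HasDerivAt (fun u : ℝ => -(1 / 2) * u) (-(1 / 2)) u := by
      simpa using (hasDerivAt_id u).const_mul (-(1 / 2) : ℝ)
    exact h1.comp u h2
  refine ⟨fun u => ?_, fun u => ?_⟩
  · rw [hfun]
    simp only
    rw [deriv_cgf (hmem _)]
    constructor
    · refine div_pos ?_ (hmgf _)
      rw [integral_pos_iff_support_of_nonneg_ae _ (hint1 _), pos_iff_ne_zero]
      · intro hz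
        have : ∀ᵐ v ∂ρ, False := by
          filter_upwards [hae, measure_eq_zero_iff_ae_notMem.1 hz] with v hv hv'
          exact hv' (mul_pos hv.1 (Real.exp_pos _)).ne'
        simp [hρ0] at this
      · exact hae.mono fun v hv => mul_nonneg hv.1.le (Real.exp_pos _).le
    · rw [div_le_one (hmgf _), mgf]
      refine integral_mono_ae (hint1 _) (hint _) (hae.mono fun v hv => ?_)
      exact mul_le_of_le_one_left (Real.exp_pos _).le hv.2
  · rw [(hder u).deriv]
    obtain ⟨h1, h2⟩ := hsecond (-(1 / 2) * u)
    exact ⟨hder u, by linarith, by linarith⟩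

end Shrinkage

/-! ### Stein's identity and the risk of spherically symmetric estimators -/

section Stein

variable {p : ℕ}

local notation "E" => EuclideanSpace ℝ (Fin p)

theorem risk_eq_lintegral (θ : E) {δ : E → E} (hδ : Measurable δ) :
    risk θ δ = ∫⁻ y, ENNReal.ofReal (gaussDensity p 1 (‖y - θ‖ ^ 2) * ‖θ - δ y‖ ^ 2) := by
  have hmul : multivariateGaussian θ (1 : Matrix (Fin p) (Fin p) ℝ) =
      (stdGaussian E).map (fun x => θ + x) := by
    simp [multivariateGaussian]
  rw [risk, hmul, lintegral_map (by fun_prop) (by fun_prop), stdGaussian_eq_withDensity,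
    lintegral_withDensity_eq_lintegral_mul _ (by fun_prop) (by fun_prop),
    ← lintegral_add_left_eq_self (fun y : E =>
      ENNReal.ofReal (gaussDensity p 1 (‖y - θ‖ ^ 2) * ‖θ - δ y‖ ^ 2)) θ]
  refine lintegral_congr fun y => ?_
  simp only [Pi.mul_apply, add_sub_cancel_left]
  rw [ENNReal.ofReal_mul (gaussDensity_pos one_pos _).le]

theorem hasDerivAt_norm_add_smul_sq (y e : E) :
    HasDerivAt (fun t : ℝ => ‖y + t • e‖ ^ 2) (2 * inner ℝ y e) 0 := by
  have h : (fun t : ℝ => ‖y + t • e‖ ^ 2) =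
      fun t => ‖y‖ ^ 2 + 2 * (t * inner ℝ y e) + t ^ 2 * ‖e‖ ^ 2 := by
    ext t
    rw [norm_add_sq_real, norm_smul, inner_smul_right, mul_pow, Real.norm_eq_abs, sq_abs]
  rw [h]
  have h1 := (((hasDerivAt_id (0 : ℝ)).mul_const (inner ℝ y e : ℝ)).const_mul 2).const_add (‖y‖ ^ 2)
  have h2 := (hasDerivAt_pow 2 (0 : ℝ)).mul_const (‖e‖ ^ 2)
  simpa using h1.fun_add h2

theorem hasLineDerivAt_gaussDensity (y θ e : E) :
    HasLineDerivAt ℝ (fun y : E => gaussDensity p 1 (‖y - θ‖ ^ 2))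
      (-(inner ℝ (y - θ) e * gaussDensity p 1 (‖y - θ‖ ^ 2))) y e := by
  have h1 := hasDerivAt_norm_add_smul_sq (y - θ) e
  have h2 : HasDerivAt (gaussDensity p 1) (gaussDensity p 1 (‖y - θ‖ ^ 2) * (-1 / (2 * 1)))
      (‖y - θ + (0 : ℝ) • e‖ ^ 2) := by
    simp only [zero_smul, add_zero]
    have := (((hasDerivAt_id (‖y - θ‖ ^ 2)).fun_neg.div_const (2 * 1)).exp).const_mul
      ((2 * Real.pi * 1) ^ (-(p : ℝ) / 2))
    rw [← mul_assoc] at this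
    exact this
  have h3 := h2.comp (0 : ℝ) h1
  unfold HasLineDerivAt
  have e1 : (fun t : ℝ => gaussDensity p 1 (‖y + t • e - θ‖ ^ 2)) =
      gaussDensity p 1 ∘ fun t : ℝ => ‖y - θ + t • e‖ ^ 2 := by
    ext t; simp [sub_add_eq_add_sub]
  rw [e1]
  exact h3.congr_deriv (by ring)

theorem hasLineDerivAt_radial {s s' : ℝ → ℝ} (hs : ∀ u, HasDerivAt s (s' u) u) (y e : E) :
    HasLineDerivAt ℝ (fun y : E => s (‖y‖ ^ 2) * inner ℝ y e)
      (2 * inner ℝ y e ^ 2 * s' (‖y‖ ^ 2) + s (‖y‖ ^ 2) * ‖e‖ ^ 2) y e := by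
  have h1 := hasDerivAt_norm_add_smul_sq y e
  have h2 : HasDerivAt s (s' (‖y‖ ^ 2)) (‖y + (0 : ℝ) • e‖ ^ 2) := by
    simpa using hs (‖y‖ ^ 2)
  have h3 := h2.comp (0 : ℝ) h1
  have h4 : HasDerivAt (fun t : ℝ => (inner ℝ (y + t • e) e : ℝ)) (‖e‖ ^ 2) 0 := by
    have : (fun t : ℝ => (inner ℝ (y + t • e) e : ℝ)) = fun t => inner ℝ y e + t * ‖e‖ ^ 2 := by
      ext t
      rw [inner_add_left, real_inner_smul_left, real_inner_self_eq_norm_sq]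
    rw [this]
    simpa using ((hasDerivAt_id (0 : ℝ)).mul_const (‖e‖ ^ 2)).const_add (inner ℝ y e : ℝ)
  unfold HasLineDerivAt
  refine (h3.mul h4).congr_deriv ?_
  simp only [Function.comp_apply, zero_smul, add_zero]
  ring

/-- Stein's identity along a direction, for the field `y ↦ s (‖y‖ ^ 2) y`. -/
theorem stein_identity_inner {s s' : ℝ → ℝ} (hs : ∀ u, HasDerivAt s (s' u) u)
    (hs1 : ∀ u, |s u| ≤ 1) (hs'1 : ∀ u, |s' u| ≤ 1) (hs' : Measurable s') (θ e : E)
    (he : ‖e‖ = 1) :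
    Integrable (fun y => gaussDensity p 1 (‖y - θ‖ ^ 2) *
      (s (‖y‖ ^ 2) * (inner ℝ y e * inner ℝ (y - θ) e))) ∧
    Integrable (fun y => gaussDensity p 1 (‖y - θ‖ ^ 2) *
      (2 * inner ℝ y e ^ 2 * s' (‖y‖ ^ 2) + s (‖y‖ ^ 2))) ∧
    ∫ y, gaussDensity p 1 (‖y - θ‖ ^ 2) * (s (‖y‖ ^ 2) * (inner ℝ y e * inner ℝ (y - θ) e)) =
      ∫ y, gaussDensity p 1 (‖y - θ‖ ^ 2) *
        (2 * inner ℝ y e ^ 2 * s' (‖y‖ ^ 2) + s (‖y‖ ^ 2)) := by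
  have hsc : Continuous s := continuous_iff_continuousAt.2 fun u => (hs u).continuousAt
  have hinner : ∀ y : E, |inner ℝ y e| ≤ ‖y‖ := fun y => by
    simpa [he] using abs_real_inner_le_norm y e
  have hs0 : ∀ u, 0 ≤ |s u| := fun u => abs_nonneg _
  have i0 : Integrable fun y : E => gaussDensity p 1 (‖y - θ‖ ^ 2) *
      (s (‖y‖ ^ 2) * inner ℝ y e) := by
    refine integrable_gaussDensity_smul one_pos θ (C := 1)
      (Measurable.aestronglyMeasurable (by fun_prop)) fun y => ?_
    rw [Real.norm_eq_abs, abs_mul]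
    have := mul_le_mul (hs1 (‖y‖ ^ 2)) (hinner y) (abs_nonneg _) zero_le_one
    nlinarith [sq_nonneg (‖y‖ - 1), norm_nonneg y]
  have i1 : Integrable fun y : E => gaussDensity p 1 (‖y - θ‖ ^ 2) *
      (s (‖y‖ ^ 2) * (inner ℝ y e * inner ℝ (y - θ) e)) := by
    refine integrable_gaussDensity_smul one_pos θ (C := 1 + ‖θ‖)
      (Measurable.aestronglyMeasurable (by fun_prop)) fun y => ?_
    rw [Real.norm_eq_abs, abs_mul, abs_mul]
    have h1 := (hinner (y - θ)).trans (norm_sub_le y θ)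
    have h2 : |inner ℝ y e| * |inner ℝ (y - θ) e| ≤ ‖y‖ * (‖y‖ + ‖θ‖) :=
      mul_le_mul (hinner y) h1 (abs_nonneg _) (norm_nonneg _)
    have h3 := mul_le_mul (hs1 (‖y‖ ^ 2)) h2 (by positivity) zero_le_one
    refine h3.trans ?_
    nlinarith [sq_nonneg (‖y‖ - 1), norm_nonneg y, norm_nonneg θ,
      mul_nonneg (norm_nonneg θ) (sq_nonneg (‖y‖ - 1)), mul_nonneg (norm_nonneg θ) (norm_nonneg y)]
  have i2 : Integrable fun y : E => gaussDensity p 1 (‖y - θ‖ ^ 2) *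
      (2 * inner ℝ y e ^ 2 * s' (‖y‖ ^ 2) + s (‖y‖ ^ 2)) := by
    refine integrable_gaussDensity_smul one_pos θ (C := 2)
      (Measurable.aestronglyMeasurable (by fun_prop)) fun y => ?_
    refine (norm_add_le _ _).trans ?_
    rw [norm_mul, Real.norm_eq_abs, Real.norm_eq_abs, Real.norm_eq_abs, abs_mul, abs_two, abs_pow]
    have h1 : |inner ℝ y e| ^ 2 ≤ ‖y‖ ^ 2 := by gcongr; exact hinner y
    have h2 := mul_le_mul h1 (hs'1 (‖y‖ ^ 2)) (abs_nonneg _) (sq_nonneg _)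
    have h3 := hs1 (‖y‖ ^ 2)
    nlinarith [sq_nonneg ‖y‖]
  refine ⟨i1, i2, ?_⟩
  -- Integration by parts along `e`: the Gaussian density has logarithmic derivative `-⟪y - θ, e⟫`.
  have hmain := integral_bilinear_hasLineDerivAt_right_eq_neg_left_of_integrable
    (μ := (volume : Measure E)) (B := ContinuousLinearMap.mul ℝ ℝ) (v := e)
    (f := fun y : E => s (‖y‖ ^ 2) * inner ℝ y e)
    (f' := fun y : E => 2 * inner ℝ y e ^ 2 * s' (‖y‖ ^ 2) + s (‖y‖ ^ 2) * ‖e‖ ^ 2)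
    (g := fun y : E => gaussDensity p 1 (‖y - θ‖ ^ 2))
    (g' := fun y : E => -(inner ℝ (y - θ) e * gaussDensity p 1 (‖y - θ‖ ^ 2)))
    (i2.congr (Eventually.of_forall fun y => by
      simp only [ContinuousLinearMap.mul_apply', he]; ring))
    ((i1.neg).congr (Eventually.of_forall fun y => by
      simp only [ContinuousLinearMap.mul_apply', Pi.neg_apply]; ring))
    (i0.congr (Eventually.of_forall fun y => by
      simp only [ContinuousLinearMap.mul_apply']; ring))
    (fun y _ => hasLineDerivAt_radial hs y e) (fun y _ => hasLineDerivAt_gaussDensity y θ e)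
  simp only [ContinuousLinearMap.mul_apply', he, one_pow, mul_one, mul_neg, integral_neg,
    neg_inj] at hmain
  calc _ = _ := integral_congr_ae (Eventually.of_forall fun y => by ring)
    _ = _ := hmain
    _ = _ := integral_congr_ae (Eventually.of_forall fun y => by simp only; ring)

/-- Stein's identity for the field `y ↦ s (‖y‖ ^ 2) y`. -/
theorem stein_identity {s s' : ℝ → ℝ} (hs : ∀ u, HasDerivAt s (s' u) u)
    (hs1 : ∀ u, |s u| ≤ 1) (hs'1 : ∀ u, |s' u| ≤ 1) (hs' : Measurable s') (θ : E) :
    Integrable (fun y => gaussDensity p 1 (‖y - θ‖ ^ 2) * (s (‖y‖ ^ 2) * inner ℝ (y - θ) y)) ∧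
    Integrable (fun y => gaussDensity p 1 (‖y - θ‖ ^ 2) *
      (2 * ‖y‖ ^ 2 * s' (‖y‖ ^ 2) + p * s (‖y‖ ^ 2))) ∧
    ∫ y, gaussDensity p 1 (‖y - θ‖ ^ 2) * (s (‖y‖ ^ 2) * inner ℝ (y - θ) y) =
      ∫ y, gaussDensity p 1 (‖y - θ‖ ^ 2) *
        (2 * ‖y‖ ^ 2 * s' (‖y‖ ^ 2) + p * s (‖y‖ ^ 2)) := by
  -- Summing the directional identities over an orthonormal basis produces the divergence of the
  -- field.
  set b := EuclideanSpace.basisFun (Fin p) ℝ with hb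
  have h := fun i => stein_identity_inner hs hs1 hs'1 hs' θ (b i) (b.norm_eq_one i)
  have e1 : ∀ y : E, gaussDensity p 1 (‖y - θ‖ ^ 2) * (s (‖y‖ ^ 2) * inner ℝ (y - θ) y) =
      ∑ i, gaussDensity p 1 (‖y - θ‖ ^ 2) *
        (s (‖y‖ ^ 2) * (inner ℝ y (b i) * inner ℝ (y - θ) (b i))) := fun y => by
    rw [← Finset.mul_sum, ← Finset.mul_sum, ← b.sum_inner_mul_inner]
    congr 2
    exact Finset.sum_congr rfl fun i _ => by rw [real_inner_comm y (b i)]; ring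
  have e2 : ∀ y : E, gaussDensity p 1 (‖y - θ‖ ^ 2) *
        (2 * ‖y‖ ^ 2 * s' (‖y‖ ^ 2) + p * s (‖y‖ ^ 2)) =
      ∑ i, gaussDensity p 1 (‖y - θ‖ ^ 2) *
        (2 * inner ℝ y (b i) ^ 2 * s' (‖y‖ ^ 2) + s (‖y‖ ^ 2)) := fun y => by
    rw [← Finset.mul_sum, Finset.sum_add_distrib, ← Finset.sum_mul, ← Finset.mul_sum,
      b.sum_sq_inner_left]
    simp
  simp_rw [e1, e2]
  refine ⟨integrable_finsetSum _ fun i _ => (h i).1, integrable_finsetSum _ fun i _ => (h i).2.1,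
    ?_⟩
  rw [integral_finsetSum _ fun i _ => (h i).1, integral_finsetSum _ fun i _ => (h i).2.1]
  exact Finset.sum_congr rfl fun i _ => (h i).2.2

/-- Stein's identity for the constant `s = 1` at mean 0, then translated to `θ`. -/
theorem integral_gaussDensity_mul_sq_norm (θ : E) :
    Integrable (fun y => gaussDensity p 1 (‖y - θ‖ ^ 2) * ‖y - θ‖ ^ 2) ∧
      ∫ y, gaussDensity p 1 (‖y - θ‖ ^ 2) * ‖y - θ‖ ^ 2 = p := by
  obtain ⟨h1, -, h2⟩ := stein_identity (p := p) (s := fun _ => 1) (s' := fun _ => 0)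
    (fun u => hasDerivAt_const u 1) (by simp) (by simp) measurable_const 0
  have h3 := integral_gaussDensity (p := p) one_pos 0
  simp only [sub_zero, one_mul, real_inner_self_eq_norm_sq, mul_zero, zero_add, mul_one,
    integral_mul_const] at h1 h2 h3
  rw [h3, one_mul] at h2
  exact ⟨h1.comp_sub_right θ, by
    rw [integral_sub_right_eq_self (fun y : E => gaussDensity p 1 (‖y‖ ^ 2) * ‖y‖ ^ 2) θ, h2]⟩

theorem risk_id (θ : E) : risk θ (fun y : E => y) = p := by
  obtain ⟨h1, h2⟩ := integral_gaussDensity_mul_sq_norm θ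
  rw [risk_eq_lintegral θ measurable_id', ← ofReal_integral_eq_lintegral_ofReal]
  · simp_rw [norm_sub_rev θ]
    rw [h2, ENNReal.ofReal_natCast]
  · simpa only [norm_sub_rev θ] using h1
  · exact Eventually.of_forall fun y => mul_nonneg (gaussDensity_pos one_pos _).le (sq_nonneg _)

/-- Stein's unbiased risk estimate for `y ↦ (1 - s (‖y‖ ^ 2)) y`. -/
theorem risk_radial_shrinkage {s s' : ℝ → ℝ} (hs : ∀ u, HasDerivAt s (s' u) u)
    (hs1 : ∀ u, |s u| ≤ 1) (hs'1 : ∀ u, |s' u| ≤ 1) (hs' : Measurable s') (θ : E) :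
    Integrable (fun y => gaussDensity p 1 (‖y - θ‖ ^ 2) * (s (‖y‖ ^ 2) ^ 2 * ‖y‖ ^ 2 -
        2 * (2 * ‖y‖ ^ 2 * s' (‖y‖ ^ 2) + p * s (‖y‖ ^ 2)))) ∧
    risk θ (fun y : E => (1 - s (‖y‖ ^ 2)) • y) =
      ENNReal.ofReal (p + ∫ y, gaussDensity p 1 (‖y - θ‖ ^ 2) * (s (‖y‖ ^ 2) ^ 2 * ‖y‖ ^ 2 -
        2 * (2 * ‖y‖ ^ 2 * s' (‖y‖ ^ 2) + p * s (‖y‖ ^ 2)))) := by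
  have hsc : Continuous s := continuous_iff_continuousAt.2 fun u => (hs u).continuousAt
  obtain ⟨i1, h1⟩ := integral_gaussDensity_mul_sq_norm θ
  obtain ⟨i2, i3, h2⟩ := stein_identity hs hs1 hs'1 hs' θ
  have i4 : Integrable fun y : E => gaussDensity p 1 (‖y - θ‖ ^ 2) *
      (s (‖y‖ ^ 2) ^ 2 * ‖y‖ ^ 2) := by
    refine integrable_gaussDensity_smul one_pos θ (C := 1)
      (Measurable.aestronglyMeasurable (by fun_prop)) fun y => ?_
    rw [norm_mul, norm_pow, norm_pow, Real.norm_eq_abs, norm_norm]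
    have := pow_le_one₀ (n := 2) (abs_nonneg _) (hs1 (‖y‖ ^ 2))
    nlinarith [sq_nonneg ‖y‖]
  have e1 : ∀ y : E, gaussDensity p 1 (‖y - θ‖ ^ 2) * (s (‖y‖ ^ 2) ^ 2 * ‖y‖ ^ 2 -
        2 * (2 * ‖y‖ ^ 2 * s' (‖y‖ ^ 2) + p * s (‖y‖ ^ 2))) =
      gaussDensity p 1 (‖y - θ‖ ^ 2) * (s (‖y‖ ^ 2) ^ 2 * ‖y‖ ^ 2) -
      2 * (gaussDensity p 1 (‖y - θ‖ ^ 2) *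
        (2 * ‖y‖ ^ 2 * s' (‖y‖ ^ 2) + p * s (‖y‖ ^ 2))) := fun y => by ring
  have e2 : ∀ y : E, gaussDensity p 1 (‖y - θ‖ ^ 2) * ‖θ - (1 - s (‖y‖ ^ 2)) • y‖ ^ 2 =
      gaussDensity p 1 (‖y - θ‖ ^ 2) * ‖y - θ‖ ^ 2 +
        (gaussDensity p 1 (‖y - θ‖ ^ 2) * (s (‖y‖ ^ 2) ^ 2 * ‖y‖ ^ 2) -
      2 * (gaussDensity p 1 (‖y - θ‖ ^ 2) * (s (‖y‖ ^ 2) * inner ℝ (y - θ) y))) := fun y => by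
    -- Expanding around `y - θ` isolates the cross term that Stein's identity evaluates.
    have : θ - (1 - s (‖y‖ ^ 2)) • y = s (‖y‖ ^ 2) • y - (y - θ) := by
      rw [sub_smul, one_smul]; abel
    rw [this, norm_sub_sq_real (s (‖y‖ ^ 2) • y), norm_smul, mul_pow, Real.norm_eq_abs, sq_abs,
      real_inner_smul_left, real_inner_comm]
    ring
  simp_rw [e1]
  refine ⟨i4.sub (i3.const_mul 2), ?_⟩
  rw [risk_eq_lintegral θ (by fun_prop), ← ofReal_integral_eq_lintegral_ofReal]
  · simp_rw [e2]
    refine congrArg ENNReal.ofReal ((integral_add i1 (i4.sub (i2.const_mul 2))).trans ?_)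
    simp only [Pi.sub_apply]
    rw [integral_sub i4 (i2.const_mul 2),
      integral_sub i4 (i3.const_mul 2), integral_const_mul, integral_const_mul, h1, h2]
  · simp_rw [e2]
    exact i1.add (i4.sub (i2.const_mul 2))
  · exact Eventually.of_forall fun y => mul_nonneg (gaussDensity_pos one_pos _).le (sq_nonneg _)

end Stein

/-! ### Risk far from the origin -/

theorem gaussDensity_one_le_gaussDensity_one {p : ℕ} {a b : ℝ} (h : b ≤ a) :
    gaussDensity p 1 a ≤ gaussDensity p 1 b := by
  unfold gaussDensity
  gcongr

/-- If `u s(u) → ∞`, the estimator `y ↦ (1 - s (‖y‖ ^ 2)) y` has risk larger than `p` far from the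
origin. -/
theorem exists_forall_lt_risk_radial_shrinkage {p : ℕ} {s s' : ℝ → ℝ}
    (hs : ∀ u, HasDerivAt s (s' u) u) (hs0 : ∀ u, 0 < s u) (hs1 : ∀ u, s u ≤ 1)
    (hs'0 : ∀ u, s' u ≤ 0) (hs'1 : ∀ u, -1 ≤ s' u) (hs' : Measurable s')
    (hlim : Tendsto (fun u => u * s u) atTop atTop) :
    ∃ r : ℝ, ∀ θ : EuclideanSpace ℝ (Fin p), r ≤ ‖θ‖ →
      (p : ℝ≥0∞) < risk θ (fun y => (1 - s (‖y‖ ^ 2)) • y) := by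
  have hanti : Antitone s := antitone_of_deriv_nonpos (fun u => (hs u).differentiableAt)
    fun u => by rw [(hs u).deriv]; exact hs'0 u
  obtain ⟨u₁, hu₁⟩ := eventually_atTop.1 (hlim.eventually_ge_atTop (2 * p + 1))
  set R : ℝ := max u₁ 1 with hR
  have hR1 : 1 ≤ R := le_max_right _ _
  have hRu : ∀ u, R ^ 2 ≤ u → 2 * p + 1 ≤ u * s u := fun u hu =>
    hu₁ u ((le_max_left u₁ 1).trans (by nlinarith))
  set m : ℝ := s ((R + 4) ^ 2) with hm
  have hmpos : 0 < m := hs0 _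
  set b₁ : ℝ := (volume : Measure (EuclideanSpace ℝ (Fin p))).real (Metric.ball 0 1) with hb₁
  set b₀ : ℝ := (volume : Measure (EuclideanSpace ℝ (Fin p))).real (Metric.ball 0 R) with hb₀
  have hb₁pos : 0 < b₁ := ENNReal.toReal_pos (Metric.measure_ball_pos _ _ one_pos).ne'
    measure_ball_lt_top.ne
  have hb₀nn : 0 ≤ b₀ := ENNReal.toReal_nonneg
  -- Makes `exp (2 t - 2)` exceed `2 p b₀ / (m b₁)` for `t ≥ t₀`; the summand 3 keeps the centre `c`
  -- below on the segment from 0 to `θ`.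
  set t₀ : ℝ := 2 * p * b₀ / (m * b₁) + 3 with ht₀
  have ht₀3 : 3 ≤ t₀ := by
    have : 0 ≤ 2 * p * b₀ / (m * b₁) := by positivity
    linarith
  refine ⟨R + t₀, fun θ hθ => ?_⟩
  set t : ℝ := ‖θ‖ - R with ht
  have htt : t₀ ≤ t := by linarith
  have hθpos : 0 < ‖θ‖ := by linarith
  obtain ⟨hint, hrisk⟩ := risk_radial_shrinkage (p := p) hs
    (fun u => abs_le.2 ⟨by linarith [hs0 u], hs1 u⟩)
    (fun u => abs_le.2 ⟨hs'1 u, by linarith [hs'0 u]⟩) hs' θ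
  set f : EuclideanSpace ℝ (Fin p) → ℝ := fun y => s (‖y‖ ^ 2) ^ 2 * ‖y‖ ^ 2 -
    2 * (2 * ‖y‖ ^ 2 * s' (‖y‖ ^ 2) + p * s (‖y‖ ^ 2)) with hf
  have hf1 : ∀ y, s (‖y‖ ^ 2) * (‖y‖ ^ 2 * s (‖y‖ ^ 2) - 2 * p) ≤ f y := fun y => by
    have := mul_nonneg (sq_nonneg ‖y‖) (neg_nonneg.2 (hs'0 (‖y‖ ^ 2)))
    simp only [hf]
    nlinarith
  have hfout : ∀ y, R ≤ ‖y‖ → s (‖y‖ ^ 2) ≤ f y := fun y hy => by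
    have := hRu (‖y‖ ^ 2) (by gcongr)
    have h2 := mul_le_mul_of_nonneg_left (by linarith : 1 ≤ ‖y‖ ^ 2 * s (‖y‖ ^ 2) - 2 * p)
      (hs0 (‖y‖ ^ 2)).le
    linarith [hf1 y]
  have hfin : ∀ y, -(2 * p) ≤ f y := fun y => by
    have h1 := hs0 (‖y‖ ^ 2)
    have h2 := hs1 (‖y‖ ^ 2)
    have h3 : (0 : ℝ) ≤ p := Nat.cast_nonneg p
    have h4 : 0 ≤ s (‖y‖ ^ 2) * (‖y‖ ^ 2 * s (‖y‖ ^ 2)) := by positivity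
    nlinarith [hf1 y, mul_nonneg h3 (sub_nonneg.2 h2)]
  -- The unit ball around `c` lies outside radius `R` and within `t - 2` of `θ`, while the ball of
  -- radius `R` stays at distance at least `t`. The density ratio is `exp ((t ^ 2 - (t - 2) ^ 2) /
  -- 2) = exp (2 t - 2)`.
  set c : EuclideanSpace ℝ (Fin p) := ((R + 3) / ‖θ‖) • θ with hc
  have hcn : ‖c‖ = R + 3 := by
    rw [hc, norm_smul, Real.norm_of_nonneg (by positivity)]
    field_simp
  have hcθ : ‖c - θ‖ = t - 3 := by
    have : c - θ = ((R + 3) / ‖θ‖ - 1) • θ := by rw [hc, sub_smul, one_smul]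
    rw [this, norm_smul, Real.norm_of_nonpos, ht]
    · field_simp
      ring
    · rw [sub_nonpos, div_le_one hθpos]
      linarith
  set B₁ := Metric.ball c 1 with hB₁
  set B₀ := Metric.ball (0 : EuclideanSpace ℝ (Fin p)) R with hB₀
  set a₁ : ℝ := gaussDensity p 1 ((t - 2) ^ 2) with ha₁
  set a₀ : ℝ := gaussDensity p 1 (t ^ 2) with ha₀
  have hlower : ∀ y, B₁.indicator (fun _ => a₁ * m) y - B₀.indicator (fun _ => a₀ * (2 * p)) y ≤
      gaussDensity p 1 (‖y - θ‖ ^ 2) * f y := by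
    intro y
    have hφ := gaussDensity_pos (p := p) one_pos (‖y - θ‖ ^ 2)
    by_cases hy0 : y ∈ B₀
    · have hyn : ‖y‖ < R := by simpa [hB₀] using hy0
      have hy1 : y ∉ B₁ := fun h => by
        have h1 : ‖y - c‖ < 1 := by simpa [hB₁, dist_eq_norm] using h
        have h2 : ‖c‖ ≤ ‖y‖ + ‖y - c‖ := by
          have := norm_sub_le y (y - c); simpa using this
        linarith
      rw [Set.indicator_of_notMem hy1, Set.indicator_of_mem hy0]
      have h1 : t ≤ ‖y - θ‖ := by
        have := norm_sub_le y (y - θ)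
        simp only [sub_sub_cancel] at this
        linarith
      have h2 : gaussDensity p 1 (‖y - θ‖ ^ 2) ≤ a₀ :=
        gaussDensity_one_le_gaussDensity_one (pow_le_pow_left₀ (by linarith) h1 2)
      have h3 : (0 : ℝ) ≤ p := Nat.cast_nonneg p
      nlinarith [mul_le_mul_of_nonneg_left (hfin y) hφ.le,
        mul_le_mul_of_nonneg_right h2 (by linarith : (0 : ℝ) ≤ 2 * p)]
    · have hyn : R ≤ ‖y‖ := by simpa [hB₀] using hy0
      rw [Set.indicator_of_notMem hy0, sub_zero]
      by_cases hy1 : y ∈ B₁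
      · have h1 : ‖y - c‖ < 1 := by simpa [hB₁, dist_eq_norm] using hy1
        rw [Set.indicator_of_mem hy1]
        have h2 : ‖y - θ‖ ≤ t - 2 := by
          have := norm_add_le (y - c) (c - θ)
          simp only [sub_add_sub_cancel] at this
          linarith
        have h3 : ‖y‖ ≤ R + 4 := by
          have := norm_add_le (y - c) c
          simp only [sub_add_cancel] at this
          linarith
        have h4 : m ≤ f y := (hanti (by gcongr)).trans (hfout y hyn)
        have h5 : a₁ ≤ gaussDensity p 1 (‖y - θ‖ ^ 2) :=
          gaussDensity_one_le_gaussDensity_one (pow_le_pow_left₀ (norm_nonneg _) h2 2)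
        exact mul_le_mul h5 h4 hmpos.le hφ.le
      · rw [Set.indicator_of_notMem hy1]
        exact mul_nonneg hφ.le ((hs0 _).le.trans (hfout y hyn))
  have hi₁ : Integrable (B₁.indicator fun _ => a₁ * m) :=
    (integrable_indicator_iff measurableSet_ball).2
      (integrableOn_const measure_ball_lt_top.ne)
  have hi₀ : Integrable (B₀.indicator fun _ => a₀ * (2 * p)) :=
    (integrable_indicator_iff measurableSet_ball).2
      (integrableOn_const measure_ball_lt_top.ne)
  have hge : b₁ * (a₁ * m) - b₀ * (a₀ * (2 * p)) ≤
      ∫ y, gaussDensity p 1 (‖y - θ‖ ^ 2) * f y := by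
    have h := integral_mono (hi₁.sub hi₀) hint hlower
    have hvol : (volume : Measure (EuclideanSpace ℝ (Fin p))).real B₁ = b₁ := by
      rw [hb₁, hB₁, Measure.real, Measure.real, Measure.addHaar_ball_center]
    have h2 := integral_sub hi₁ hi₀
    rw [integral_indicator measurableSet_ball, integral_indicator measurableSet_ball,
      setIntegral_const, setIntegral_const, hvol] at h2
    exact h2.symm.le.trans h
  have hpos : 0 < b₁ * (a₁ * m) - b₀ * (a₀ * (2 * p)) := by
    have h1 : a₁ = a₀ * Real.exp (2 * t - 2) := by
      rw [ha₁, ha₀, gaussDensity, gaussDensity, mul_assoc (_ ^ _), ← Real.exp_add]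
      congr 2
      ring
    have h2 : 2 * p * b₀ < m * b₁ * Real.exp (2 * t - 2) := by
      have h3 := Real.add_one_le_exp (2 * t - 2)
      have h4 : 2 * p * b₀ / (m * b₁) < Real.exp (2 * t - 2) := by linarith
      rw [div_lt_iff₀ (by positivity)] at h4
      linarith
    have ha₀pos : 0 < a₀ := gaussDensity_pos one_pos _
    rw [h1]
    nlinarith [mul_lt_mul_of_pos_left h2 ha₀pos]
  rw [hrisk, ← ENNReal.ofReal_natCast, ENNReal.ofReal_lt_ofReal_iff']
  constructor
  · linarith
  · have : (0 : ℝ) ≤ p := Nat.cast_nonneg p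
    linarith

/-- An estimator whose risk exceeds `p` somewhere is not minimax. -/
theorem not_isMinimax_of_lt_risk {p : ℕ}
    {δ : EuclideanSpace ℝ (Fin p) → EuclideanSpace ℝ (Fin p)} {θ : EuclideanSpace ℝ (Fin p)}
    (h : (p : ℝ≥0∞) < risk θ δ) : ¬ IsMinimax δ := by
  intro hmin
  have h1 : (⨅ (η : EuclideanSpace ℝ (Fin p) → EuclideanSpace ℝ (Fin p)) (_ : Measurable η),
      ⨆ θ, risk θ η) ≤ p :=
    (iInf₂_le (fun y => y) measurable_id').trans (iSup_le fun θ => (risk_id θ).le)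
  have h2 : risk θ δ ≤ ⨆ θ, risk θ δ := le_iSup (fun θ => risk θ δ) θ
  exact absurd (h.trans_le (h2.trans (hmin.le.trans h1))) (lt_irrefl _)

end BNN

theorem theorem2p6 (d : ℕ) (hd : 1 ≤ d) (n : ℕ → ℕ)
    (hn : ∀ ℓ, 1 ≤ ℓ → ℓ < d → 1 ≤ n ℓ) (hp : 3 ≤ n d)
    (σ : ℕ → ℝ) (hσ : ∀ ℓ, 1 ≤ ℓ → ℓ ≤ d → 0 < σ ℓ)
    (x : EuclideanSpace ℝ (Fin (n 0))) (hx : x ≠ 0) :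
    Measurable (BNN.bnnRule n σ d x) ∧
    (∀ y, BNN.bnnRule n σ d x y = (1 - BNN.psi n σ d x (‖y‖ ^ 2)) • y) ∧
    (∃ c : ℝ, 0 < c ∧ ∃ u₀ : ℝ, ∀ u : ℝ, u₀ ≤ u →
      c * u ^ (1 / (d : ℝ)) ≤ u * BNN.psi n σ d x u) ∧
    Tendsto (fun u : ℝ => u * BNN.psi n σ d x u) atTop atTop ∧
    (∃ r : ℝ, ∀ θ : EuclideanSpace ℝ (Fin (n d)), r ≤ ‖θ‖ →
      (n d : ℝ≥0∞) < BNN.risk θ (BNN.bnnRule n σ d x)) ∧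
    ¬ BNN.IsMinimax (BNN.bnnRule n σ d x) := by
  have hp1 : 1 ≤ n d := by omega
  have hrule := BNN.bnnRule_eq hd hn hp1 hσ hx
  obtain ⟨c, hc, hle⟩ := BNN.exists_le_mul_psi hd hn hσ hx
  obtain ⟨hval, hder⟩ := BNN.exists_hasDerivAt_shrinkage (n d)
    (BNN.ae_nonneg_varianceLaw n σ d x) (BNN.varianceLaw_ne_zero hn)
  -- `psi` is by definition `shrinkage` for the law `varianceLaw`.
  change ∀ u, 0 < BNN.psi n σ d x u ∧ BNN.psi n σ d x u ≤ 1 at hval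
  change ∀ u, HasDerivAt (BNN.psi n σ d x) (deriv (BNN.psi n σ d x) u) u ∧
    -1 ≤ deriv (BNN.psi n σ d x) u ∧ deriv (BNN.psi n σ d x) u ≤ 0 at hder
  have hfun : BNN.bnnRule n σ d x = fun y => (1 - BNN.psi n σ d x (‖y‖ ^ 2)) • y := funext hrule
  have hcont : Continuous (BNN.psi n σ d x) :=
    continuous_iff_continuousAt.2 fun u => (hder u).1.continuousAt
  have hd0 : (0 : ℝ) < d := by exact_mod_cast hd
  have hlim : Tendsto (fun u : ℝ => u * BNN.psi n σ d x u) atTop atTop :=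
    tendsto_atTop_mono' atTop ((eventually_ge_atTop 1).mono hle)
      ((tendsto_rpow_atTop (one_div_pos.2 hd0)).const_mul_atTop hc)
  have hrisk : ∃ r : ℝ, ∀ θ : EuclideanSpace ℝ (Fin (n d)), r ≤ ‖θ‖ →
      (n d : ℝ≥0∞) < BNN.risk θ (BNN.bnnRule n σ d x) := by
    rw [hfun]
    exact BNN.exists_forall_lt_risk_radial_shrinkage (fun u => (hder u).1)
      (fun u => (hval u).1) (fun u => (hval u).2) (fun u => (hder u).2.2) (fun u => (hder u).2.1)
      (measurable_deriv _) hlim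
  refine ⟨?_, hrule, ⟨c, hc, 1, hle⟩, hlim, hrisk, ?_⟩
  · rw [hfun]
    fun_prop
  · obtain ⟨r, hr⟩ := hrisk
    have : Nontrivial (EuclideanSpace ℝ (Fin (n d))) := by
      have : Nonempty (Fin (n d)) := ⟨⟨0, hp1⟩⟩
      infer_instance
    obtain ⟨θ, hθ⟩ := NormedSpace.exists_lt_norm ℝ (EuclideanSpace ℝ (Fin (n d))) r
    exact BNN.not_isMinimax_of_lt_risk (hr θ hθ.le)
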